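/- Let $\alpha>0$, $\beta>0$ satisfy $\min\{\alpha+3\beta,\,3\alpha+\beta\}>4\alpha\beta$, and let $\theta_0\in L^2(\mathbb{R}^2)$ be real-valued. Write $\Lambda_{x_j}^{s}$ for the Fourier multiplier on $\mathbb{R}^2$ with symbol $|\xi_j|^{s}$ (frequency normalized so that $\partial_{x_j}$ has symbol $i\xi_j$) and $\mathcal{R}_j=\partial_{x_j}(-\Delta)^{-1/2}$ for the Riesz transforms. Consider the surface quasi-geostrophic equation with anisotropic fractional dissipation $$\partial_t\theta+(u\cdot\nabla)\theta+\Lambda_{x_1}^{2\alpha}\theta+\Lambda_{x_2}^{2\beta}\theta=0,\qquad u=(-\mathcal{R}_2\theta,\ \mathcal{R}_1\theta),\qquad \theta(\cdot,0)=\theta_0, \tag{1}$$ and its linear part $$\partial_t\widetilde\theta+\Lambda_{x_1}^{2\alpha}\widetilde\theta+\Lambda_{x_2}^{2\beta}\widetilde\theta=0,\qquad \widetilde\theta(\cdot,0)=\theta_0. \tag{2}$$ A (global, Leray-type) weak solution of (1) is a (strongly measurable) map $\theta:[0,\infty)\to L^2(\mathbb{R}^2)$, with real-valued $\theta(t)$,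 such that for every Schwartz function $\varphi$ and every $t\ge 0$ $$\int\theta(t)\varphi\,dx-\int\theta_0\varphi\,dx=\int_0^t\!\!\int\theta\,\big(u\cdot\nabla\varphi-\Lambda_{x_1}^{2\alpha}\varphi-\Lambda_{x_2}^{2\beta}\varphi\big)\,dx\,ds,$$ and such that, for $s=0$ and for almost every $s>0$, the energy inequality $$\|\theta(t)\|_{L^2}^2+2\int_s^t\big(\|\Lambda_{x_1}^{\alpha}\theta(\tau)\|_{L^2}^2+\|\Lambda_{x_2}^{\beta}\theta(\tau)\|_{L^2}^2\big)\,d\tau\le\|\theta(s)\|_{L^2}^2\qquad\text{for all }t\ge s$$ holds (with $\theta(0)=\theta_0$). A solution of (2) is a (strongly measurable) map $\widetilde\theta:[0,\infty)\to L^2(\mathbb{R}^2)$, with real-valued $\widetilde\theta(t)$, bounded on bounded time intervals, that satisfies the same integral identity without the term $u\cdot\nabla\varphi$. Then there is a constant $C_0>0$, depending only on $\alpha$, $\beta$ and $\theta_0$, such that for every weak solution $\theta$ of (1) and every solution $\widetilde\theta$ of (2) $$\|\theta(t)-\widetilde\theta(t)\|_{L^2}\le C_0(1+t)^{-\frac{\min\{\alpha+3\beta,\,3\alpha+\beta\}-4\alpha\beta}{8\alpha\beta}}\qquad\text{for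 all }t\ge 0.$$ -/

import Mathlib

open MeasureTheory FourierTransform SchwartzMap
open scoped ENNReal

noncomputable section

namespace AnisoSQG

/-- The plane `ℝ²` with its Euclidean norm; the coordinates `x₁, x₂` are `x 0, x 1`. -/
abbrev Plane : Type := EuclideanSpace ℝ (Fin 2)

/-- Real-valued `L²(ℝ²)`. -/
abbrev RealL2 : Type := Lp ℝ 2 (volume : Measure Plane)

/-- Complex-valued `L²(ℝ²)`. -/
abbrev ComplexL2 : Type := Lp ℂ 2 (volume : Measure Plane)

/-- A real-valued `L²` function regarded as a complex-valued one. -/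
def toComplex (f : RealL2) : ComplexL2 := Complex.ofRealCLM.compLp f

open Classical in
/-- The Fourier multiplier operator with symbol `m` on `L²(ℝ²)`, that is `𝓕⁻¹ (m · 𝓕 f)`, with
domain the set of `f` such that `m · 𝓕 f` is square integrable (outside the domain the value is
the junk value `0`). Here `𝓕` is the unitary Fourier transform with kernel `e^{-2πi x·ξ}`, so that
`∂ⱼ` has the symbol `2πi ξⱼ`. -/
def fourierMultiplier (m : Plane → ℂ) (f : ComplexL2) : ComplexL2 :=
  if h : MemLp (fun ξ => m ξ * 𝓕 f ξ) 2 (volume : Measure Plane) then 𝓕⁻ (h.toLp _) else 0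

/-- The symbol of `Λ_{xⱼ}^s = (-∂ⱼ²)^{s/2}`. -/
def absDerivSymbol (j : Fin 2) (s : ℝ) (ξ : Plane) : ℝ := (2 * Real.pi * |ξ j|) ^ s

/-- The operator `Λ_{xⱼ}^s` on `L²(ℝ²)`. -/
def absDeriv (j : Fin 2) (s : ℝ) (f : ComplexL2) : ComplexL2 :=
  fourierMultiplier (fun ξ => (absDerivSymbol j s ξ : ℂ)) f

/-- The symbol of the Riesz transform `Rⱼ = ∂ⱼ Λ⁻¹`. -/
def rieszSymbol (j : Fin 2) (ξ : Plane) : ℂ := Complex.I * ((ξ j / ‖ξ‖ : ℝ) : ℂ)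

/-- The Riesz transform `Rⱼ = ∂ⱼ Λ⁻¹` on `L²(ℝ²)`. -/
def riesz (j : Fin 2) (f : ComplexL2) : ComplexL2 := fourierMultiplier (rieszSymbol j) f

/-- The squared norm `‖Λ_{xⱼ}^s f‖²_{L²}`, computed on the Fourier side by Plancherel's theorem,
with the value `∞` when `f` is not in the domain of `Λ_{xⱼ}^s`. -/
def absDerivNormSq (j : Fin 2) (s : ℝ) (f : RealL2) : ℝ≥0∞ :=
  ∫⁻ ξ : Plane, ‖(absDerivSymbol j s ξ : ℂ) * 𝓕 (toComplex f) ξ‖ₑ ^ 2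

lemma measurable_absDerivSymbol (j : Fin 2) (s : ℝ) : Measurable (absDerivSymbol j s) := by
  unfold absDerivSymbol
  fun_prop

lemma measurable_rieszSymbol (j : Fin 2) : Measurable (rieszSymbol j) := by
  unfold rieszSymbol
  fun_prop

/-- The Riesz transforms are everywhere defined on `L²`. -/
lemma memLp_riesz (j : Fin 2) (f : ComplexL2) :
    MemLp (fun ξ => rieszSymbol j ξ * 𝓕 f ξ) 2 (volume : Measure Plane) := by
  refine MemLp.of_le (Lp.memLp (𝓕 f))
    ((measurable_rieszSymbol j).aestronglyMeasurable.mul (Lp.aestronglyMeasurable _))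
    (Filter.Eventually.of_forall fun ξ => ?_)
  have h : ‖rieszSymbol j ξ‖ ≤ 1 := by
    have h1 : |ξ j| ≤ ‖ξ‖ := by simpa using PiLp.norm_apply_le ξ j
    simp only [rieszSymbol, norm_mul, Complex.norm_I, one_mul, Complex.norm_real,
      Real.norm_eq_abs, abs_div, abs_norm]
    exact div_le_one_of_le₀ h1 (norm_nonneg _)
  calc ‖rieszSymbol j ξ * 𝓕 f ξ‖ = ‖rieszSymbol j ξ‖ * ‖𝓕 f ξ‖ := norm_mul _ _
    _ ≤ 1 * ‖𝓕 f ξ‖ := by gcongr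
    _ = ‖𝓕 f ξ‖ := one_mul _

/-- Schwartz functions are in the domain of `Λ_{xⱼ}^s` for every `s ≥ 0`. -/
lemma memLp_absDeriv_schwartz (j : Fin 2) {s : ℝ} (hs : 0 ≤ s) (φ : 𝓢(Plane, ℂ)) :
    MemLp (fun ξ => (absDerivSymbol j s ξ : ℂ) * 𝓕 (φ.toLp 2 : ComplexL2) ξ) 2
      (volume : Measure Plane) := by
  obtain ⟨N, hN⟩ := exists_nat_ge s
  have hg : Function.HasTemperateGrowth (fun ξ : Plane => (1 + ‖ξ‖ ^ 2 : ℝ) ^ N) := by fun_prop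
  have hψ := ((smulLeftCLM ℂ (fun ξ : Plane => (1 + ‖ξ‖ ^ 2 : ℝ) ^ N) (𝓕 φ)).memLp 2
    (volume : Measure Plane)).const_mul (((4 * Real.pi) ^ s : ℝ) : ℂ)
  refine MemLp.of_le hψ ((Complex.measurable_ofReal.comp
    (measurable_absDerivSymbol j s)).aestronglyMeasurable.mul (Lp.aestronglyMeasurable _)) ?_
  have hae : ((𝓕 (φ.toLp 2 : ComplexL2) : ComplexL2) : Plane → ℂ) =ᵐ[volume]
      ((𝓕 φ : 𝓢(Plane, ℂ)) : Plane → ℂ) := by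
    rw [SchwartzMap.toLp_fourier_eq]
    exact SchwartzMap.coeFn_toLp _ _ _
  filter_upwards [hae] with ξ hξ
  rw [hξ, norm_mul, norm_mul, smulLeftCLM_apply_apply hg, norm_smul, ← mul_assoc]
  gcongr
  have h1 : |ξ j| ≤ ‖ξ‖ := by simpa using PiLp.norm_apply_le ξ j
  have h2 : ‖ξ‖ ≤ 1 + ‖ξ‖ ^ 2 := by nlinarith [sq_nonneg (‖ξ‖ - 1), norm_nonneg ξ]
  have h3 : (1 : ℝ) ≤ 1 + ‖ξ‖ ^ 2 := by nlinarith [sq_nonneg ‖ξ‖]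
  have hpi := Real.pi_pos
  rw [Complex.norm_real, Complex.norm_real, Real.norm_of_nonneg (by unfold absDerivSymbol; positivity),
    Real.norm_of_nonneg (by positivity), Real.norm_of_nonneg (by positivity), absDerivSymbol]
  calc (2 * Real.pi * |ξ j|) ^ s ≤ (4 * Real.pi * (1 + ‖ξ‖ ^ 2)) ^ s := by
        apply Real.rpow_le_rpow (by positivity) _ hs
        nlinarith [abs_nonneg (ξ j)]
    _ = (4 * Real.pi) ^ s * (1 + ‖ξ‖ ^ 2) ^ s := Real.mul_rpow (by positivity) (by positivity)
    _ ≤ (4 * Real.pi) ^ s * (1 + ‖ξ‖ ^ 2) ^ N := by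
        gcongr
        exact (Real.rpow_le_rpow_of_exponent_le h3 hN).trans_eq (Real.rpow_natCast _ _)

/-- On its domain, `absDerivNormSq` is the square of the `L²` norm of `Λ_{xⱼ}^s f`. -/
lemma absDerivNormSq_eq (j : Fin 2) (s : ℝ) (f : RealL2)
    (h : MemLp (fun ξ => (absDerivSymbol j s ξ : ℂ) * 𝓕 (toComplex f) ξ) 2
      (volume : Measure Plane)) :
    absDerivNormSq j s f = ‖absDeriv j s (toComplex f)‖ₑ ^ 2 := by
  have e : ‖absDeriv j s (toComplex f)‖ₑ = ‖h.toLp _‖ₑ := by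
    rw [absDeriv, fourierMultiplier, dif_pos h, ← ofReal_norm, ← ofReal_norm,
      ← Lp.norm_fourier_eq, FourierTransform.fourier_fourierInv_eq]
  rw [e, Lp.enorm_toLp, eLpNorm_eq_lintegral_rpow_enorm_toReal (by norm_num) (by norm_num),
    absDerivNormSq]
  simp only [ENNReal.toReal_ofNat, ENNReal.rpow_ofNat, ← ENNReal.rpow_natCast]
  rw [← ENNReal.rpow_mul]
  norm_num

/-- The velocity `u = R^⊥ θ = (-R₂ θ, R₁ θ)`. -/
def velocity (θ : RealL2) : Fin 2 → ComplexL2 :=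
  ![-riesz 1 (toComplex θ), riesz 0 (toComplex θ)]

/-- The weak form `∫ θ u · ∇φ` of the transport term, where `u = R^⊥ θ`. -/
def transportPairing (θ : RealL2) (φ : 𝓢(Plane, ℂ)) : ℂ :=
  ∫ x : Plane, (θ x : ℂ) *
    ∑ j : Fin 2, velocity θ j x * fderiv ℝ φ x (EuclideanSpace.single j 1)

/-- The weak form `∫ θ (Λ_{x₁}^{2α} φ + Λ_{x₂}^{2β} φ)` of the dissipation term. -/
def dissipationPairing (α β : ℝ) (θ : RealL2) (φ : 𝓢(Plane, ℂ)) : ℂ :=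
  ∫ x : Plane, (θ x : ℂ) *
    (absDeriv 0 (2 * α) (φ.toLp 2) x + absDeriv 1 (2 * β) (φ.toLp 2) x)

/-- Global weak solutions (of Leray type) of
`∂ₜθ + u · ∇θ + Λ_{x₁}^{2α} θ + Λ_{x₂}^{2β} θ = 0`, `u = R^⊥ θ`, `θ(0) = θ₀`, with `θ₀ ∈ L²`:
the equation holds in the sense of distributions, integrated in time, and the energy inequality
holds on `[s, t]` for `s = 0`, for almost every `s > 0`, and for all `t ≥ s`. Only the values of `θ`
at nonnegative times matter. -/
structure IsWeakSolution (α β : ℝ) (θ₀ : RealL2) (θ : ℝ → RealL2) : Prop where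
  measurable : AEStronglyMeasurable θ (volume.restrict (Set.Ioi (0 : ℝ)))
  equation : ∀ (φ : 𝓢(Plane, ℂ)) (t : ℝ), 0 ≤ t →
    (∫ x : Plane, (θ t x : ℂ) * φ x) - ∫ x : Plane, (θ₀ x : ℂ) * φ x =
      ∫ s in (0 : ℝ)..t, (transportPairing (θ s) φ - dissipationPairing α β (θ s) φ)
  energy_zero : ∀ t : ℝ, 0 ≤ t →
    ‖θ t‖ₑ ^ 2 + 2 * ∫⁻ τ in Set.Ioc 0 t, (absDerivNormSq 0 α (θ τ) + absDerivNormSq 1 β (θ τ))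
      ≤ ‖θ₀‖ₑ ^ 2
  energy_ae : ∀ᵐ s ∂(volume.restrict (Set.Ioi (0 : ℝ))), ∀ t : ℝ, s ≤ t →
    ‖θ t‖ₑ ^ 2 + 2 * ∫⁻ τ in Set.Ioc s t, (absDerivNormSq 0 α (θ τ) + absDerivNormSq 1 β (θ τ))
      ≤ ‖θ s‖ₑ ^ 2

/-- Weak solutions, locally bounded in time with values in `L²`, of the linear equation
`∂ₜθ + Λ_{x₁}^{2α} θ + Λ_{x₂}^{2β} θ = 0`, `θ(0) = θ₀`. -/
structure IsLinearSolution (α β : ℝ) (θ₀ : RealL2) (θ : ℝ → RealL2) : Prop where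
  measurable : AEStronglyMeasurable θ (volume.restrict (Set.Ioi (0 : ℝ)))
  locally_bounded : ∀ T : ℝ, ∃ M : ℝ, ∀ t ∈ Set.Icc 0 T, ‖θ t‖ ≤ M
  equation : ∀ (φ : 𝓢(Plane, ℂ)) (t : ℝ), 0 ≤ t →
    (∫ x : Plane, (θ t x : ℂ) * φ x) - ∫ x : Plane, (θ₀ x : ℂ) * φ x =
      -∫ s in (0 : ℝ)..t, dissipationPairing α β (θ s) φ

end AnisoSQG

end

noncomputable section

namespace AnisoSQG

/-! ### An integrating factor identity -/

/-! On the Fourier side the equation reads ∂ₜV = N - mV, where `m` is the dissipation symbol and `N`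
is the transform of the transport term. Since θu is a product of two `L²` functions, its transform
is bounded by ‖θ₀‖², and the divergence contributes a factor |ξ|: |N(t,ξ)| ≤ C|ξ| with C depending
on θ₀ only. Apart from the energy inequality, this is the only estimate on the nonlinearity. By
`IsFourierSolution.ae_eq_duhamel` every weak solution equals V = L + W, with L = e^{-tm}X₀ and W the
Duhamel integral of N. The linear solution is L, so by Plancherel the quantity to estimate is ‖W‖.

Two facts control W. Pointwise, |W(t,ξ)| ≤ C|ξ|t, which makes low frequencies small. Moreover |V|² -
|W|² solves y' = 2 Re(L̄N) - 2my; combined with the energy inequality for V, this yields one for W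
whose only source is the work of N on L, at most C ‖|ξ|e^{-tm}‖ ‖X₀‖ (`energy_comparison`). Let G(τ)
= ∫|ξ|²e^{-2τm} and μ = min(α+3β, 3α+β). Anisotropic scaling gives G(τ) ≲ τ^{-(2γ+2)} for τ ≥ 1,
with γ = (μ-4αβ)/(4αβ) (`exists_integral_normSq_mul_exp_le`); the hypothesis says γ > 0.

Fourier splitting at the level m = ρ ~ 1/t (`fourier_splitting`), from a time s comparable to t, has
errors t√G(t) ~ t^{-γ} from the work and t²G(t) ~ t^{-2γ} from low frequencies. Hence (1+K)‖W(t)‖² ≤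
‖W(s)‖² + D t^{-γ} with K = 4^γ, which iterates (`decay_of_dyadic_recursion`) to ‖W(t)‖² ≲ t^{-γ}.
The square root gives the claimed exponent. -/

lemma exp_mul_primitive_sub_real (a c : ℝ) {k : ℝ → ℝ}
    (hk : ∀ x y : ℝ, IntervalIntegrable k volume x y) (s t : ℝ) :
    Real.exp (-(a * t)) * (c + ∫ r in (0 : ℝ)..t, k r)
      - Real.exp (-(a * s)) * (c + ∫ r in (0 : ℝ)..s, k r) =
      ∫ σ in s..t, (Real.exp (-(a * σ)) * k σ
        - a * (Real.exp (-(a * σ)) * (c + ∫ r in (0 : ℝ)..σ, k r))) := by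
  have hprim : ∀ σ, (c + ∫ r in (0 : ℝ)..σ, k r) = (c + ∫ r in (0 : ℝ)..s, k r) +
      ∫ r in s..σ, k r := fun σ => by
    rw [add_assoc, intervalIntegral.integral_add_adjacent_intervals (hk _ _) (hk _ _)]
  -- `k` is merely integrable in time, so its primitive need not be `C¹`; the product rule is
  -- integrated in the class of absolutely continuous functions.
  have hf : AbsolutelyContinuousOnInterval (fun x => Real.exp (-(a * x))) s t := by
    apply ContDiffOn.absolutelyContinuousOnInterval
    fun_prop
  have hg : AbsolutelyContinuousOnInterval (fun x => c + ∫ r in (0 : ℝ)..x, k r) s t := by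
    have h1 := (hk s t).absolutelyContinuousOnInterval_intervalIntegral (c := s) (by simp)
    have h2 : AbsolutelyContinuousOnInterval (fun _ : ℝ => c + ∫ r in (0 : ℝ)..s, k r) s t := by
      apply ContDiffOn.absolutelyContinuousOnInterval
      fun_prop
    rw [show (fun x => c + ∫ r in (0 : ℝ)..x, k r) = fun x => (c + ∫ r in (0 : ℝ)..s, k r) +
      ∫ r in s..x, k r from funext hprim]
    exact h2.fun_add h1
  rw [← hf.integral_deriv_mul_eq_sub hg]
  apply intervalIntegral.integral_congr_ae
  filter_upwards [(hk s t).ae_hasDerivAt_integral] with x hx hxs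
  have h1 : HasDerivAt (fun x => Real.exp (-(a * x))) (Real.exp (-(a * x)) * -(a * 1)) x :=
    (((hasDerivAt_id x).const_mul a).neg).exp
  have h2 : HasDerivAt (fun x => c + ∫ r in (0 : ℝ)..x, k r) (k x) x := by
    have := (hx (Set.uIoc_subset_uIcc hxs) s (by simp)).const_add
      (c + ∫ r in (0 : ℝ)..s, k r)
    exact this.congr_of_eventuallyEq (Filter.Eventually.of_forall fun y => hprim y)
  rw [h1.deriv, h2.deriv]
  ring

/-- The integrating factor identity `(e^{-at} I)' = e^{-at} (I' - a I)`, in integrated form, for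
a primitive `I` of a locally integrable function. -/
lemma exp_mul_primitive_sub (a : ℝ) (c : ℂ) {k : ℝ → ℂ}
    (hk : ∀ x y : ℝ, IntervalIntegrable k volume x y) (s t : ℝ) :
    (Real.exp (-(a * t)) : ℂ) * (c + ∫ r in (0 : ℝ)..t, k r)
      - (Real.exp (-(a * s)) : ℂ) * (c + ∫ r in (0 : ℝ)..s, k r) =
      ∫ σ in s..t, ((Real.exp (-(a * σ)) : ℂ) * k σ
        - a * ((Real.exp (-(a * σ)) : ℂ) * (c + ∫ r in (0 : ℝ)..σ, k r))) := by
  have hre : ∀ x y : ℝ, IntervalIntegrable (fun r => (k r).re) volume x y := fun x y =>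
    ⟨(hk x y).1.re, (hk x y).2.re⟩
  have him : ∀ x y : ℝ, IntervalIntegrable (fun r => (k r).im) volume x y := fun x y =>
    ⟨(hk x y).1.im, (hk x y).2.im⟩
  have ire : ∀ x y : ℝ, ∫ r in x..y, (k r).re = (∫ r in x..y, k r).re := fun x y =>
    Complex.reCLM.intervalIntegral_comp_comm (hk x y)
  have iim : ∀ x y : ℝ, ∫ r in x..y, (k r).im = (∫ r in x..y, k r).im := fun x y =>
    Complex.imCLM.intervalIntegral_comp_comm (hk x y)
  have hcont : Continuous fun σ => ∫ r in (0 : ℝ)..σ, k r :=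
    intervalIntegral.continuous_primitive hk 0
  have hint : IntervalIntegrable (fun σ : ℝ => (Real.exp (-(a * σ)) : ℂ) * k σ
        - a * ((Real.exp (-(a * σ)) : ℂ) * (c + ∫ r in (0 : ℝ)..σ, k r))) volume s t := by
    refine ((hk s t).continuousOn_mul ?_).sub (Continuous.intervalIntegrable ?_ _ _)
    · exact (by fun_prop : Continuous fun σ : ℝ => (Real.exp (-(a * σ)) : ℂ)).continuousOn
    · fun_prop
  apply Complex.ext
  · have := exp_mul_primitive_sub_real a c.re hre s t
    rw [← Complex.reCLM_apply (∫ σ in s..t, _), ← Complex.reCLM.intervalIntegral_comp_comm hint]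
    simp only [ire] at this
    simpa [-Complex.ofReal_exp] using this
  · have := exp_mul_primitive_sub_real a c.im him s t
    rw [← Complex.imCLM_apply (∫ σ in s..t, _), ← Complex.imCLM.intervalIntegral_comp_comm hint]
    simp only [iim] at this
    simpa [-Complex.ofReal_exp] using this

/-! ### Gaussian-type integrals of the anisotropic symbol -/

/-- The symbol of the dissipation `Λ_{x₁}^{2α} + Λ_{x₂}^{2β}`. -/
def dissipationSymbol (α β : ℝ) (ξ : Plane) : ℝ :=
  absDerivSymbol 0 (2 * α) ξ + absDerivSymbol 1 (2 * β) ξ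

lemma dissipationSymbol_nonneg (α β : ℝ) (ξ : Plane) : 0 ≤ dissipationSymbol α β ξ := by
  unfold dissipationSymbol absDerivSymbol
  positivity

lemma continuous_dissipationSymbol {α β : ℝ} (hα : 0 ≤ α) (hβ : 0 ≤ β) :
    Continuous (dissipationSymbol α β) := by
  unfold dissipationSymbol absDerivSymbol
  refine Continuous.add ?_ ?_
  · exact Continuous.rpow_const (by fun_prop) fun _ => Or.inr (by positivity)
  · exact Continuous.rpow_const (by fun_prop) fun _ => Or.inr (by positivity)

lemma integrable_abs_rpow_mul_exp {p q b : ℝ} (hp : 0 < p) (hq : -1 < q) (hb : 0 < b) :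
    Integrable (fun x : ℝ => |x| ^ q * Real.exp (-b * |x| ^ p)) := by
  have h := (integrable_fun_norm_addHaar (volume : Measure ℝ)
    (f := fun x : ℝ => x ^ q * Real.exp (-b * x ^ p))).mpr (by
      simpa using integrableOn_rpow_mul_exp_neg_mul_rpow hq hp hb)
  simpa using h

lemma integral_abs_rpow_mul_exp {p q b : ℝ} (hp : 0 < p) (hq : -1 < q) (hb : 0 < b) :
    ∫ x : ℝ, |x| ^ q * Real.exp (-b * |x| ^ p) =
      2 * (b ^ (-(q + 1) / p) * (1 / p) * Real.Gamma ((q + 1) / p)) := by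
  rw [integral_comp_abs (f := fun x : ℝ => x ^ q * Real.exp (-b * x ^ p)),
    integral_rpow_mul_exp_neg_mul_rpow hp hq hb]

lemma exists_integral_abs_rpow_mul_exp_le {p q : ℝ} (hp : 0 < p) (hq : -1 < q) :
    ∃ c : ℝ, 0 ≤ c ∧ ∀ τ : ℝ, 0 < τ →
      Integrable (fun x : ℝ => |x| ^ q * Real.exp (-(2 * τ * (2 * Real.pi * |x|) ^ p))) ∧
      ∫ x : ℝ, |x| ^ q * Real.exp (-(2 * τ * (2 * Real.pi * |x|) ^ p)) =
        c * τ ^ (-((q + 1) / p)) := by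
  have hpi := Real.pi_pos
  have hG : 0 ≤ Real.Gamma ((q + 1) / p) := (Real.Gamma_pos_of_pos (by
    apply div_pos <;> linarith)).le
  refine ⟨2 * ((2 * (2 * Real.pi) ^ p) ^ (-(q + 1) / p) * (1 / p) * Real.Gamma ((q + 1) / p)),
    by positivity, fun τ hτ => ?_⟩
  have e : ∀ x : ℝ, -(2 * τ * (2 * Real.pi * |x|) ^ p) =
      -(2 * (2 * Real.pi) ^ p * τ) * |x| ^ p := fun x => by
    rw [Real.mul_rpow (by positivity) (abs_nonneg x)]
    ring
  simp only [e]
  refine ⟨integrable_abs_rpow_mul_exp hp hq (by positivity), ?_⟩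
  rw [integral_abs_rpow_mul_exp hp hq (by positivity), Real.mul_rpow (by positivity) hτ.le,
    neg_div]
  ring

/-- The identification of the plane with `ℝ × ℝ`. -/
lemma measurePreserving_coords :
    MeasurePreserving (fun ξ : Plane => (ξ 0, ξ 1)) volume volume :=
  (volume_preserving_finTwoArrow ℝ).comp (PiLp.volume_preserving_ofLp (Fin 2))

lemma measurableEmbedding_coords :
    MeasurableEmbedding (fun ξ : Plane => (ξ 0, ξ 1)) :=
  (MeasurableEquiv.finTwoArrow (α := ℝ)).measurableEmbedding.comp
    (MeasurableEquiv.toLp 2 (Fin 2 → ℝ)).symm.measurableEmbedding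

/-- Since ‖ξ‖² = ξ₁² + ξ₂² and the exponential factors, each term is a product of one-dimensional
integrals, of order τ^{-(3/(2α)+1/(2β))} and τ^{-(1/(2α)+3/(2β))}. For τ ≥ 1 the slower power
dominates, hence the minimum. -/
lemma exists_integral_normSq_mul_exp_le {α β : ℝ} (hα : 0 < α) (hβ : 0 < β) :
    ∃ c : ℝ, 0 ≤ c ∧ ∀ τ : ℝ, 0 < τ →
      Integrable (fun ξ : Plane => ‖ξ‖ ^ 2 * Real.exp (-(2 * τ * dissipationSymbol α β ξ))) ∧
      (1 ≤ τ → ∫ ξ : Plane, ‖ξ‖ ^ 2 * Real.exp (-(2 * τ * dissipationSymbol α β ξ)) ≤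
        c * τ ^ (-(min (α + 3 * β) (3 * α + β) / (2 * α * β)))) := by
  obtain ⟨a2, ha2, h2⟩ := exists_integral_abs_rpow_mul_exp_le (p := 2 * α) (q := 2)
    (by positivity) (by norm_num)
  obtain ⟨a0, ha0, h0⟩ := exists_integral_abs_rpow_mul_exp_le (p := 2 * α) (q := 0)
    (by positivity) (by norm_num)
  obtain ⟨b2, hb2, k2⟩ := exists_integral_abs_rpow_mul_exp_le (p := 2 * β) (q := 2)
    (by positivity) (by norm_num)
  obtain ⟨b0, hb0, k0⟩ := exists_integral_abs_rpow_mul_exp_le (p := 2 * β) (q := 0)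
    (by positivity) (by norm_num)
  refine ⟨a2 * b0 + a0 * b2, by positivity, fun τ hτ => ?_⟩
  let F : ℝ × ℝ → ℝ := fun z =>
        (|z.1| ^ (2 : ℝ) * Real.exp (-(2 * τ * (2 * Real.pi * |z.1|) ^ (2 * α)))) *
        (|z.2| ^ (0 : ℝ) * Real.exp (-(2 * τ * (2 * Real.pi * |z.2|) ^ (2 * β)))) +
        (|z.1| ^ (0 : ℝ) * Real.exp (-(2 * τ * (2 * Real.pi * |z.1|) ^ (2 * α)))) *
        (|z.2| ^ (2 : ℝ) * Real.exp (-(2 * τ * (2 * Real.pi * |z.2|) ^ (2 * β))))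
  have e : (fun ξ : Plane => ‖ξ‖ ^ 2 * Real.exp (-(2 * τ * dissipationSymbol α β ξ))) =
      fun ξ : Plane => F (ξ 0, ξ 1) := by
    funext ξ
    simp only [F, EuclideanSpace.norm_sq_eq, Fin.sum_univ_two, dissipationSymbol,
      absDerivSymbol, Real.norm_eq_abs, mul_add, neg_add, Real.exp_add, Real.rpow_zero,
      Real.rpow_two]
    ring
  have i1 := (h2 τ hτ).1.mul_prod (k0 τ hτ).1
  have i2 := (h0 τ hτ).1.mul_prod (k2 τ hτ).1
  rw [e]
  refine ⟨measurePreserving_coords.integrable_comp_of_integrable (i1.add i2), fun hτ1 => ?_⟩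
  have hF : ∫ z, F z = (∫ x : ℝ, |x| ^ (2 : ℝ) * Real.exp (-(2 * τ * (2 * Real.pi * |x|) ^ (2 * α)))) *
      (∫ x : ℝ, |x| ^ (0 : ℝ) * Real.exp (-(2 * τ * (2 * Real.pi * |x|) ^ (2 * β)))) +
      (∫ x : ℝ, |x| ^ (0 : ℝ) * Real.exp (-(2 * τ * (2 * Real.pi * |x|) ^ (2 * α)))) *
      (∫ x : ℝ, |x| ^ (2 : ℝ) * Real.exp (-(2 * τ * (2 * Real.pi * |x|) ^ (2 * β)))) := by
    rw [Measure.volume_eq_prod, ← integral_prod_mul, ← integral_prod_mul]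
    exact integral_add i1 i2
  rw [measurePreserving_coords.integral_comp measurableEmbedding_coords F, hF, (h2 τ hτ).2, (h0 τ hτ).2, (k2 τ hτ).2, (k0 τ hτ).2]
  have m1 : a2 * τ ^ (-((2 + 1) / (2 * α))) * (b0 * τ ^ (-((0 + 1) / (2 * β)))) =
      a2 * b0 * τ ^ (-((α + 3 * β) / (2 * α * β))) := by
    rw [mul_mul_mul_comm, ← Real.rpow_add hτ]
    congr 2
    field_simp
    ring
  have m2 : a0 * τ ^ (-((0 + 1) / (2 * α))) * (b2 * τ ^ (-((2 + 1) / (2 * β)))) =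
      a0 * b2 * τ ^ (-((3 * α + β) / (2 * α * β))) := by
    rw [mul_mul_mul_comm, ← Real.rpow_add hτ]
    congr 2
    field_simp
    ring
  rw [m1, m2, add_mul]
  gcongr
  · exact min_le_left _ _
  · exact min_le_right _ _

/-! ### Duhamel's formula on the Fourier side -/

/-- The solution of `∂ₜ W = N - m W`, `W(0) = 0`. -/
def duhamelIntegral (m : Plane → ℝ) (N : ℝ → Plane → ℂ) (t : ℝ) (ξ : Plane) : ℂ :=
  (Real.exp (-(m ξ * t)) : ℂ) * ∫ σ in (0 : ℝ)..t, (Real.exp (m ξ * σ) : ℂ) * N σ ξ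

/-- The solution of `∂ₜ V = N - m V`, `V(0) = X₀`. -/
def duhamel (m : Plane → ℝ) (N : ℝ → Plane → ℂ) (X₀ : Plane → ℂ) (t : ℝ) (ξ : Plane) : ℂ :=
  (Real.exp (-(m ξ * t)) : ℂ) * X₀ ξ + duhamelIntegral m N t ξ

section Duhamel

variable {m : Plane → ℝ} {N : ℝ → Plane → ℂ} {C : ℝ} {X₀ : Plane → ℂ}

lemma intervalIntegrable_forcing (hN : StronglyMeasurable (Function.uncurry N))
    (hNb : ∀ s ξ, ‖N s ξ‖ ≤ C * ‖ξ‖) (ξ : Plane) (x y : ℝ) :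
    IntervalIntegrable (fun σ => N σ ξ) volume x y := by
  refine (intervalIntegrable_const (c := C * ‖ξ‖)).mono_fun ?_ ?_
  · exact (hN.comp_measurable measurable_prodMk_right).aestronglyMeasurable
  · exact Filter.Eventually.of_forall fun σ => (hNb σ ξ).trans (le_abs_self _)

lemma intervalIntegrable_exp_mul_forcing (hN : StronglyMeasurable (Function.uncurry N))
    (hNb : ∀ s ξ, ‖N s ξ‖ ≤ C * ‖ξ‖) (ξ : Plane) (x y : ℝ) :
    IntervalIntegrable (fun σ => (Real.exp (m ξ * σ) : ℂ) * N σ ξ) volume x y :=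
  (intervalIntegrable_forcing hN hNb ξ x y).continuousOn_mul
    (by fun_prop : Continuous fun σ : ℝ => (Real.exp (m ξ * σ) : ℂ)).continuousOn

/-- The kernel e^{-m(t-σ)} is at most 1 because m ≥ 0. The factor ‖ξ‖ is what makes the low
frequencies of the nonlinear part small. -/
lemma norm_duhamelIntegral_le (hm0 : ∀ ξ, 0 ≤ m ξ) (hNb : ∀ s ξ, ‖N s ξ‖ ≤ C * ‖ξ‖)
    {t : ℝ} (ht : 0 ≤ t) (ξ : Plane) : ‖duhamelIntegral m N t ξ‖ ≤ C * ‖ξ‖ * t := by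
  have h : ‖∫ σ in (0 : ℝ)..t, (Real.exp (m ξ * σ) : ℂ) * N σ ξ‖ ≤
      (Real.exp (m ξ * t) * (C * ‖ξ‖)) * |t - 0| := by
    refine intervalIntegral.norm_integral_le_of_norm_le_const fun σ hσ => ?_
    rw [Set.uIoc_of_le ht] at hσ
    rw [norm_mul, Complex.norm_real, Real.norm_of_nonneg (Real.exp_pos _).le]
    have := hm0 ξ
    gcongr
    · exact hσ.2
    · exact hNb σ ξ
  rw [duhamelIntegral, norm_mul, Complex.norm_real, Real.norm_of_nonneg (Real.exp_pos _).le]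
  calc _ ≤ Real.exp (-(m ξ * t)) * ((Real.exp (m ξ * t) * (C * ‖ξ‖)) * |t - 0|) := by gcongr
    _ = (Real.exp (-(m ξ * t)) * Real.exp (m ξ * t)) * (C * ‖ξ‖ * t) := by
        rw [sub_zero, abs_of_nonneg ht]; ring
    _ = C * ‖ξ‖ * t := by rw [← Real.exp_add]; simp

/-- Joint measurability follows from continuity in `t` and measurability in `ξ` (Carathéodory). -/
lemma stronglyMeasurable_duhamelIntegral (hm : Continuous m)
    (hN : StronglyMeasurable (Function.uncurry N)) (hNb : ∀ s ξ, ‖N s ξ‖ ≤ C * ‖ξ‖) :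
    StronglyMeasurable (Function.uncurry (duhamelIntegral m N)) := by
  apply stronglyMeasurable_uncurry_of_continuous_of_stronglyMeasurable
  · intro ξ
    have := intervalIntegral.continuous_primitive
      (intervalIntegrable_exp_mul_forcing (m := m) hN hNb ξ) 0
    unfold duhamelIntegral
    fun_prop
  · intro t
    refine StronglyMeasurable.mul ?_ ?_
    · exact (by fun_prop : Continuous fun ξ => (Real.exp (-(m ξ * t)) : ℂ)).stronglyMeasurable
    · have hk : StronglyMeasurable (Function.uncurry fun (ξ : Plane) (σ : ℝ) =>
          (Real.exp (m ξ * σ) : ℂ) * N σ ξ) :=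
        (by fun_prop : Continuous fun p : Plane × ℝ =>
          (Real.exp (m p.1 * p.2) : ℂ)).stronglyMeasurable.mul (hN.comp_measurable measurable_swap)
      simp only [intervalIntegral]
      exact hk.integral_prod_right.sub hk.integral_prod_right

lemma exp_mul_primitive_eq_duhamel (t : ℝ) (ξ : Plane) :
    (Real.exp (-(m ξ * t)) : ℂ) *
      (X₀ ξ + ∫ σ in (0 : ℝ)..t, (Real.exp (m ξ * σ) : ℂ) * N σ ξ) = duhamel m N X₀ t ξ := by
  rw [duhamel, duhamelIntegral, mul_add]

lemma duhamel_sub_initial (hN : StronglyMeasurable (Function.uncurry N))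
    (hNb : ∀ s ξ, ‖N s ξ‖ ≤ C * ‖ξ‖) (t : ℝ) (ξ : Plane) :
    duhamel m N X₀ t ξ - X₀ ξ = ∫ s in (0 : ℝ)..t, (N s ξ - m ξ * duhamel m N X₀ s ξ) := by
  have h := exp_mul_primitive_sub (m ξ) (X₀ ξ)
    (intervalIntegrable_exp_mul_forcing (m := m) hN hNb ξ) 0 t
  simp only [exp_mul_primitive_eq_duhamel] at h
  have h0 : duhamel m N X₀ 0 ξ = X₀ ξ := by simp [duhamel, duhamelIntegral]
  rw [h0] at h
  rw [h]
  refine intervalIntegral.integral_congr fun σ _ => ?_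
  rw [← mul_assoc, ← Complex.ofReal_mul, ← Real.exp_add]
  simp

lemma norm_duhamel_le (hm0 : ∀ ξ, 0 ≤ m ξ) (hNb : ∀ s ξ, ‖N s ξ‖ ≤ C * ‖ξ‖)
    {t : ℝ} (ht : 0 ≤ t) (ξ : Plane) : ‖duhamel m N X₀ t ξ‖ ≤ ‖X₀ ξ‖ + C * ‖ξ‖ * t := by
  refine (norm_add_le _ _).trans (add_le_add ?_ (norm_duhamelIntegral_le hm0 hNb ht ξ))
  rw [norm_mul, Complex.norm_real, Real.norm_of_nonneg (Real.exp_pos _).le]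
  exact mul_le_of_le_one_left (norm_nonneg _)
    (Real.exp_le_one_iff.mpr (neg_nonpos.mpr (mul_nonneg (hm0 ξ) ht)))

lemma aestronglyMeasurable_duhamel (hm : Continuous m)
    (hN : StronglyMeasurable (Function.uncurry N)) (hNb : ∀ s ξ, ‖N s ξ‖ ≤ C * ‖ξ‖)
    (hX : AEStronglyMeasurable X₀ volume) (μ : Measure ℝ) [SFinite μ] :
    AEStronglyMeasurable (Function.uncurry (duhamel m N X₀)) (μ.prod volume) := by
  refine AEStronglyMeasurable.add (AEStronglyMeasurable.mul ?_ hX.comp_snd)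
    (stronglyMeasurable_duhamelIntegral hm hN hNb).aestronglyMeasurable
  exact (by fun_prop : Continuous fun p : ℝ × Plane =>
    (Real.exp (-(m p.2 * p.1)) : ℂ)).aestronglyMeasurable

lemma aestronglyMeasurable_duhamel_apply (hm : Continuous m)
    (hN : StronglyMeasurable (Function.uncurry N)) (hNb : ∀ s ξ, ‖N s ξ‖ ≤ C * ‖ξ‖)
    (hX : AEStronglyMeasurable X₀ volume) (t : ℝ) :
    AEStronglyMeasurable (duhamel m N X₀ t) volume := by
  refine AEStronglyMeasurable.add (AEStronglyMeasurable.mul ?_ hX)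
    ((stronglyMeasurable_duhamelIntegral hm hN hNb).comp_measurable
      measurable_prodMk_left).aestronglyMeasurable
  exact (by fun_prop : Continuous fun ξ : Plane =>
    (Real.exp (-(m ξ * t)) : ℂ)).aestronglyMeasurable

end Duhamel

/-! ### The bilinear pairing on `L²` -/

/-- The bilinear pairing `∫ F G` on `L²`. -/
def pairing : ComplexL2 →L[ℂ] ComplexL2 →L[ℂ] ℂ :=
  (ContinuousLinearMap.mul ℂ ℂ).lpPairing volume 2 2

lemma pairing_apply (F G : ComplexL2) : pairing F G = ∫ ξ, F ξ * G ξ :=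
  (ContinuousLinearMap.mul ℂ ℂ).lpPairing_eq_integral F G

lemma pairing_toLp_right (F : ComplexL2) {g : Plane → ℂ} (hg : MemLp g 2 volume) :
    pairing F (hg.toLp g) = ∫ ξ, F ξ * g ξ := by
  rw [pairing_apply]
  refine integral_congr_ae ?_
  filter_upwards [hg.coeFn_toLp] with ξ h2
  rw [h2]

lemma norm_integral_norm_mul_le (F G : ComplexL2) : ∫ ξ, ‖F ξ‖ * ‖G ξ‖ ≤ ‖F‖ * ‖G‖ := by
  have h := (ContinuousLinearMap.mul ℂ ℂ).norm_holder_apply_apply_le (r := 1) F G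
  have h2 : ∫ ξ, ‖F ξ‖ * ‖G ξ‖ = ‖(ContinuousLinearMap.mul ℂ ℂ).holder 1 F G‖ := by
    rw [L1.norm_eq_integral_norm]
    refine integral_congr_ae ?_
    filter_upwards [(ContinuousLinearMap.mul ℂ ℂ).coeFn_holder (r := 1) F G] with ξ h1
    rw [h1]
    simp
  rw [h2]
  refine h.trans ?_
  gcongr
  calc ‖ContinuousLinearMap.mul ℂ ℂ‖ * ‖F‖ ≤ 1 * ‖F‖ := by
        gcongr
        exact ContinuousLinearMap.opNorm_mul_le ℂ ℂ
    _ = ‖F‖ := one_mul _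

lemma norm_pairing_le (F G : ComplexL2) : ‖pairing F G‖ ≤ ‖F‖ * ‖G‖ := by
  rw [pairing_apply]
  refine (norm_integral_le_integral_norm _).trans ?_
  simpa only [norm_mul] using norm_integral_norm_mul_le F G

/-! ### Uniqueness -/

/-- If `p' = -p ∘ M` weakly with `M` bounded, and `p(0) = 0`, then `p = 0`. -/
lemma eq_zero_of_eq_neg_integral {E : Type*} {P : E → Prop} {p : ℝ → E → ℂ} {M : E → E}
    {nrm : E → ℝ} {K B T : ℝ} (hK : 0 ≤ K) (hB : 0 ≤ B) (hMP : ∀ χ, P χ → P (M χ))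
    (hM : ∀ χ, P χ → nrm (M χ) ≤ K * nrm χ)
    (hb : ∀ χ, P χ → ∀ t ∈ Set.Icc 0 T, ‖p t χ‖ ≤ B * nrm χ)
    (he : ∀ χ, P χ → ∀ t ∈ Set.Icc 0 T, p t χ = -∫ s in (0 : ℝ)..t, p s (M χ))
    {χ : E} (hχ : P χ) {t : ℝ} (ht : t ∈ Set.Icc 0 T) : p t χ = 0 := by
  -- Picard iteration: each use of the equation costs a factor K and one time integration, so that
  -- the bound improves to (Kt)^n/n!.
  have key : ∀ n : ℕ, ∀ χ, P χ → ∀ t ∈ Set.Icc 0 T,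
      ‖p t χ‖ ≤ B * nrm χ * ((K * t) ^ n / n.factorial) := by
    intro n
    induction n with
    | zero => intro χ hχ t ht; simpa using hb χ hχ t ht
    | succ n ih =>
      intro χ hχ t ht
      rw [he χ hχ t ht, norm_neg]
      have h1 : ‖∫ s in (0 : ℝ)..t, p s (M χ)‖ ≤
          ∫ s in (0 : ℝ)..t, B * (K * nrm χ) * ((K * s) ^ n / n.factorial) := by
        refine intervalIntegral.norm_integral_le_of_norm_le ht.1 ?_
          (Continuous.intervalIntegrable (by fun_prop) _ _)
        refine Filter.Eventually.of_forall fun s hs => ?_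
        have hs0 : 0 ≤ s := hs.1.le
        refine (ih (M χ) (hMP χ hχ) s ⟨hs0, hs.2.trans ht.2⟩).trans ?_
        have := hM χ hχ
        gcongr
      refine h1.trans (le_of_eq ?_)
      have h2 : (fun s : ℝ => B * (K * nrm χ) * ((K * s) ^ n / n.factorial)) =
          fun s => (B * (K * nrm χ) * K ^ n / n.factorial) * s ^ n := by
        funext s; ring
      rw [h2, intervalIntegral.integral_const_mul, integral_pow, Nat.factorial_succ]
      push_cast
      field_simp
      simp only [zero_pow (Nat.succ_ne_zero n), sub_zero, mul_pow, pow_succ]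
      ring
  have hlim := (FloorSemiring.tendsto_pow_div_factorial_atTop (K * t)).const_mul (B * nrm χ)
  rw [mul_zero] at hlim
  have := ge_of_tendsto' hlim fun n => key n χ hχ t ht
  exact norm_le_zero_iff.mp this

/-- Square integrable functions supported in the closed ball of radius `R`. -/
def IsLocalTest (R : ℝ) (h : Plane → ℂ) : Prop :=
  MemLp h 2 volume ∧ ∀ ξ, R < ‖ξ‖ → h ξ = 0

lemma memLp_mul_of_bound {f : Plane → ℂ} {a : Plane → ℂ} {K : ℝ}
    (ha : AEStronglyMeasurable a volume) (hf : MemLp f 2 volume)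
    (hK : ∀ ξ, ‖a ξ‖ ≤ K) : MemLp (fun ξ => a ξ * f ξ) 2 volume := by
  refine MemLp.of_le_mul (c := K) hf (ha.mul hf.1) (Filter.Eventually.of_forall fun ξ => ?_)
  rw [norm_mul]
  gcongr
  exact hK ξ

/-- A cutoff with values in [0,1], equal to 1 on the ball of radius `R`, does not increase the
distance of a Schwartz approximant to `h`, which vanishes off that ball. The common support matters
because `m` and `N` may grow at infinity. -/
lemma exists_schwartz_approx {R : ℝ} (hR : 0 < R) {h : Plane → ℂ} (hh : IsLocalTest R h) :
    ∃ φ : ℕ → 𝓢(Plane, ℂ), (∀ n ξ, R + 1 < ‖ξ‖ → φ n ξ = 0) ∧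
      Filter.Tendsto (fun n => (φ n).toLp 2 (volume : Measure Plane)) Filter.atTop
        (nhds (hh.1.toLp h)) := by
  let η : ContDiffBump (0 : Plane) := ⟨R, R + 1, hR, by linarith⟩
  have hη : Function.HasTemperateGrowth (fun ξ : Plane => (η ξ : ℝ)) :=
    (η.hasCompactSupport.toSchwartzMap η.contDiff).hasTemperateGrowth
  have hd := (SchwartzMap.denseRange_toLpCLM (E := Plane) (F := ℂ) (p := 2)
    (μ := (volume : Measure Plane)) ENNReal.ofNat_ne_top)
  obtain ⟨u, hu, hlim⟩ := mem_closure_iff_seq_limit.mp (hd (hh.1.toLp h))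
  choose ψ hψ using hu
  refine ⟨fun n => smulLeftCLM ℂ (fun ξ : Plane => (η ξ : ℝ)) (ψ n), fun n ξ hξ => ?_, ?_⟩
  · rw [smulLeftCLM_apply_apply hη, η.zero_of_le_dist (by simpa using hξ.le), zero_smul]
  · rw [tendsto_iff_norm_sub_tendsto_zero] at hlim ⊢
    refine squeeze_zero (fun n => norm_nonneg _) (fun n => ?_) hlim
    refine Lp.norm_le_norm_of_ae_le ?_
    rw [← hψ n]
    filter_upwards [Lp.coeFn_sub ((smulLeftCLM ℂ (fun ξ : Plane => (η ξ : ℝ)) (ψ n)).toLp 2)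
      (hh.1.toLp h), Lp.coeFn_sub ((ψ n).toLp 2) (hh.1.toLp h), hh.1.coeFn_toLp,
      (ψ n).coeFn_toLp 2 volume, (smulLeftCLM ℂ (fun ξ : Plane => (η ξ : ℝ)) (ψ n)).coeFn_toLp 2
        volume] with ξ h1 h2 h3 h4 h5
    rw [h1, toLpCLM_apply, h2]
    simp only [Pi.sub_apply]
    rw [h3, h4, h5, smulLeftCLM_apply_apply hη]
    by_cases hξ : ‖ξ‖ ≤ R
    · rw [η.one_of_mem_closedBall (by simpa using hξ), one_smul]
    · rw [hh.2 ξ (not_le.mp hξ), sub_zero, sub_zero, norm_smul]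
      refine mul_le_of_le_one_left (norm_nonneg _) ?_
      rw [Real.norm_of_nonneg η.nonneg]
      exact η.le_one

/-- `L²`-valued weak solutions of `∂ₜ X = N - m X`, `X(0) = X₀`, on the Fourier side. -/
structure IsFourierSolution (m : Plane → ℝ) (N : ℝ → Plane → ℂ) (X₀ : ComplexL2)
    (X : ℝ → ComplexL2) : Prop where
  measurable : AEStronglyMeasurable X (volume.restrict (Set.Ioi (0 : ℝ)))
  locally_bounded : ∀ T : ℝ, ∃ M : ℝ, ∀ t ∈ Set.Icc 0 T, ‖X t‖ ≤ M
  equation : ∀ (φ : 𝓢(Plane, ℂ)) (t : ℝ), 0 ≤ t →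
    (∫ ξ, X t ξ * φ ξ) - ∫ ξ, X₀ ξ * φ ξ =
      ∫ s in (0 : ℝ)..t, ((∫ ξ, N s ξ * φ ξ) - ∫ ξ, X s ξ * (m ξ * φ ξ))

section Uniqueness

variable {m : Plane → ℝ} {N : ℝ → Plane → ℂ} {C : ℝ} {X₀ : ComplexL2} {X : ℝ → ComplexL2}

lemma exists_bound_on_ball (hm : Continuous m) (R : ℝ) :
    ∃ K : ℝ, 0 ≤ K ∧ ∀ ξ : Plane, ‖ξ‖ ≤ R → |m ξ| ≤ K := by
  obtain ⟨K, hK⟩ := (isCompact_closedBall (0 : Plane) R).exists_bound_of_continuousOn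
    hm.continuousOn
  exact ⟨max K 0, le_max_right _ _, fun ξ hξ =>
    (hK ξ (by simpa using hξ)).trans (le_max_left _ _)⟩

lemma memLp_indicator_forcing (hN : StronglyMeasurable (Function.uncurry N))
    (hC : 0 ≤ C) (hNb : ∀ s ξ, ‖N s ξ‖ ≤ C * ‖ξ‖) (R s : ℝ) :
    MemLp ((Metric.closedBall (0 : Plane) R).indicator (N s)) 2 volume := by
  have hf : MemLp ((Metric.closedBall (0 : Plane) R).indicator fun _ => (C * R : ℝ)) 2 volume :=
    memLp_indicator_const 2 Metric.isClosed_closedBall.measurableSet _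
      (Or.inr (isCompact_closedBall (0 : Plane) R).measure_lt_top.ne)
  refine hf.of_le ((hN.comp_measurable measurable_prodMk_left).indicator
    Metric.isClosed_closedBall.measurableSet).aestronglyMeasurable
    (Filter.Eventually.of_forall fun ξ => ?_)
  by_cases hξ : ξ ∈ Metric.closedBall (0 : Plane) R
  · rw [Set.indicator_of_mem hξ, Set.indicator_of_mem hξ]
    refine (hNb s ξ).trans (le_trans ?_ (le_abs_self _))
    have : ‖ξ‖ ≤ R := by simpa using hξ
    gcongr
  · rw [Set.indicator_of_notMem hξ, Set.indicator_of_notMem hξ]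
    simp

lemma norm_toLp_indicator_forcing_le (hN : StronglyMeasurable (Function.uncurry N))
    (hC : 0 ≤ C) (hNb : ∀ s ξ, ‖N s ξ‖ ≤ C * ‖ξ‖) (R : ℝ) :
    ∃ A : ℝ, ∀ s, ‖(memLp_indicator_forcing hN hC hNb R s).toLp _‖ ≤ A := by
  have hf : MemLp ((Metric.closedBall (0 : Plane) R).indicator fun _ => (C * R : ℝ)) 2 volume :=
    memLp_indicator_const 2 Metric.isClosed_closedBall.measurableSet _
      (Or.inr (isCompact_closedBall (0 : Plane) R).measure_lt_top.ne)
  refine ⟨‖hf.toLp _‖, fun s => Lp.norm_le_norm_of_ae_le ?_⟩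
  filter_upwards [hf.coeFn_toLp, (memLp_indicator_forcing hN hC hNb R s).coeFn_toLp] with ξ h1 h2
  rw [h1, h2]
  by_cases hξ : ξ ∈ Metric.closedBall (0 : Plane) R
  · rw [Set.indicator_of_mem hξ, Set.indicator_of_mem hξ]
    refine (hNb s ξ).trans (le_trans ?_ (le_abs_self _))
    have : ‖ξ‖ ≤ R := by simpa using hξ
    gcongr
  · rw [Set.indicator_of_notMem hξ, Set.indicator_of_notMem hξ]
    simp

/-- The multiplier `m`, truncated to a ball, is bounded. -/
lemma norm_indicator_symbol_le {K R : ℝ} (hK0 : 0 ≤ K) (hK : ∀ ξ : Plane, ‖ξ‖ ≤ R → |m ξ| ≤ K)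
    (ξ : Plane) :
    ‖(Metric.closedBall (0 : Plane) R).indicator (fun ξ => (m ξ : ℂ)) ξ‖ ≤ K := by
  by_cases hξ : ξ ∈ Metric.closedBall (0 : Plane) R
  · rw [Set.indicator_of_mem hξ, Complex.norm_real]
    exact hK ξ (by simpa using hξ)
  · rw [Set.indicator_of_notMem hξ, norm_zero]
    exact hK0

lemma aestronglyMeasurable_indicator_symbol (hm : Continuous m) (R : ℝ) :
    AEStronglyMeasurable ((Metric.closedBall (0 : Plane) R).indicator (fun ξ => (m ξ : ℂ)))
      volume :=
  ((by fun_prop : Continuous fun ξ => (m ξ : ℂ)).stronglyMeasurable.indicator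
    Metric.isClosed_closedBall.measurableSet).aestronglyMeasurable

lemma IsLocalTest.symbol_mul {R : ℝ} {h : Plane → ℂ} (hm : Continuous m) (hh : IsLocalTest R h) :
    IsLocalTest R (fun ξ => m ξ * h ξ) := by
  obtain ⟨K, hK0, hK⟩ := exists_bound_on_ball hm R
  refine ⟨?_, fun ξ hξ => by simp [hh.2 ξ hξ]⟩
  convert memLp_mul_of_bound (aestronglyMeasurable_indicator_symbol hm R) hh.1
    (norm_indicator_symbol_le hK0 hK) using 2 with ξ
  by_cases hξ : ‖ξ‖ ≤ R
  · rw [Set.indicator_of_mem (by simpa using hξ)]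
  · rw [hh.2 ξ (not_le.mp hξ), mul_zero, mul_zero]

lemma aestronglyMeasurable_integral_forcing (hN : StronglyMeasurable (Function.uncurry N))
    {h : Plane → ℂ} (hh : AEStronglyMeasurable h volume) (μ : Measure ℝ) [SFinite μ] :
    AEStronglyMeasurable (fun s => ∫ ξ, N s ξ * h ξ) μ :=
  AEStronglyMeasurable.integral_prod_right' (f := fun p : ℝ × Plane => N p.1 p.2 * h p.2)
    (hN.aestronglyMeasurable.mul hh.comp_snd)

lemma IsFourierSolution.aestronglyMeasurable_integral (hX : IsFourierSolution m N X₀ X)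
    {h : Plane → ℂ} (hh : MemLp h 2 volume) (t : ℝ) :
    AEStronglyMeasurable (fun s => ∫ ξ, X s ξ * h ξ) (volume.restrict (Set.Ioc 0 t)) := by
  have h1 := ((pairing.flip (hh.toLp h)).continuous.comp_aestronglyMeasurable
    (hX.measurable.mono_measure (Measure.restrict_mono_set volume
      (Set.Ioc_subset_Ioi_self : Set.Ioc 0 t ⊆ _))))
  simpa only [ContinuousLinearMap.flip_apply, pairing_toLp_right] using h1

/-- The weak formulation extends to locally supported `L²` test functions. -/
lemma IsFourierSolution.equation_local (hX : IsFourierSolution m N X₀ X) (hm : Continuous m)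
    (hN : StronglyMeasurable (Function.uncurry N)) (hC : 0 ≤ C)
    (hNb : ∀ s ξ, ‖N s ξ‖ ≤ C * ‖ξ‖) {R : ℝ} (hR : 0 < R) {h : Plane → ℂ}
    (hh : IsLocalTest R h) {t : ℝ} (ht : 0 ≤ t) :
    (∫ ξ, X t ξ * h ξ) - ∫ ξ, X₀ ξ * h ξ =
      ∫ s in (0 : ℝ)..t, ((∫ ξ, N s ξ * h ξ) - ∫ ξ, X s ξ * (m ξ * h ξ)) := by
  obtain ⟨φ, hφ0, hφ⟩ := exists_schwartz_approx hR hh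
  obtain ⟨K, hK0, hK⟩ := exists_bound_on_ball hm (R + 1)
  obtain ⟨A, hA⟩ := norm_toLp_indicator_forcing_le hN hC hNb (R + 1)
  obtain ⟨MX, hMX⟩ := hX.locally_bounded t
  have hφL : ∀ n, ∀ F : ComplexL2, pairing F ((φ n).toLp 2 volume) = ∫ ξ, F ξ * φ n ξ :=
    fun n F => pairing_toLp_right F ((φ n).memLp 2 volume)
  have hlim : ∀ F : ComplexL2, Filter.Tendsto (fun n => ∫ ξ, F ξ * φ n ξ) Filter.atTop
      (nhds (∫ ξ, F ξ * h ξ)) := fun F => by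
    have := ((pairing F).continuous.tendsto (hh.1.toLp h)).comp hφ
    simpa only [Function.comp_def, hφL, pairing_toLp_right] using this
  -- the truncated forcing and the truncated dissipation as elements of `L²`
  let NB : ℝ → ComplexL2 := fun s => (memLp_indicator_forcing hN hC hNb (R + 1) s).toLp _
  have hXB : ∀ s, MemLp (fun ξ => (Metric.closedBall (0 : Plane) (R + 1)).indicator
      (fun ξ => (m ξ : ℂ)) ξ * X s ξ) 2 volume := fun s =>
    memLp_mul_of_bound (aestronglyMeasurable_indicator_symbol hm _) (Lp.memLp (X s))
      (norm_indicator_symbol_le hK0 hK)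
  let XB : ℝ → ComplexL2 := fun s => (hXB s).toLp _
  have hNBe : ∀ s (f : Plane → ℂ), (∀ ξ, R + 1 < ‖ξ‖ → f ξ = 0) →
      ∫ ξ, NB s ξ * f ξ = ∫ ξ, N s ξ * f ξ := fun s f hf => by
    refine integral_congr_ae ?_
    filter_upwards [(memLp_indicator_forcing hN hC hNb (R + 1) s).coeFn_toLp] with ξ h1
    rw [h1]
    by_cases hξ : ‖ξ‖ ≤ R + 1
    · rw [Set.indicator_of_mem (by simpa using hξ)]
    · rw [hf ξ (not_le.mp hξ), mul_zero, mul_zero]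
  have hXBe : ∀ s (f : Plane → ℂ), (∀ ξ, R + 1 < ‖ξ‖ → f ξ = 0) →
      ∫ ξ, XB s ξ * f ξ = ∫ ξ, X s ξ * (m ξ * f ξ) := fun s f hf => by
    refine integral_congr_ae ?_
    filter_upwards [(hXB s).coeFn_toLp] with ξ h1
    rw [h1]
    by_cases hξ : ‖ξ‖ ≤ R + 1
    · rw [Set.indicator_of_mem (by simpa using hξ)]
      ring
    · rw [hf ξ (not_le.mp hξ)]
      simp
  have hh0 : ∀ ξ, R + 1 < ‖ξ‖ → h ξ = 0 := fun ξ hξ => hh.2 ξ (by linarith)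
  obtain ⟨L, hL⟩ := hφ.norm.bddAbove_range
  have hL' : ∀ n, ‖(φ n).toLp 2 (volume : Measure Plane)‖ ≤ L := fun n => hL ⟨n, rfl⟩
  -- The equation for `φ n` passes to the limit. The dominating constant comes from the bounds of
  -- `N` and `m` on the ball of radius `R + 1` and of ‖X s‖ on [0,t].
  refine tendsto_nhds_unique ((hlim (X t)).sub (hlim X₀)) ?_
  simp only [fun n => hX.equation (φ n) t ht]
  refine intervalIntegral.tendsto_integral_filter_of_dominated_convergence
    (fun _ => A * L + (K * MX) * L) ?_ ?_ intervalIntegrable_const ?_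
  · refine Filter.Eventually.of_forall fun n => ?_
    rw [Set.uIoc_of_le ht]
    have hφn : IsLocalTest (R + 1) (φ n) := ⟨(φ n).memLp 2 volume, hφ0 n⟩
    exact (aestronglyMeasurable_integral_forcing hN (φ n).continuous.aestronglyMeasurable _).sub
      (hX.aestronglyMeasurable_integral (hφn.symbol_mul hm).1 t)
  · refine Filter.Eventually.of_forall fun n => Filter.Eventually.of_forall fun s hs => ?_
    rw [Set.uIoc_of_le ht] at hs
    rw [← hNBe s _ (hφ0 n), ← hXBe s _ (hφ0 n), ← hφL, ← hφL]
    have hXBn : ‖XB s‖ ≤ K * MX := by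
      have h1 : ‖XB s‖ ≤ K * ‖X s‖ := by
        refine Lp.norm_le_mul_norm_of_ae_le_mul ?_
        filter_upwards [(hXB s).coeFn_toLp] with ξ h1
        rw [h1, norm_mul]
        gcongr
        exact norm_indicator_symbol_le hK0 hK ξ
      refine h1.trans ?_
      gcongr
      exact hMX s ⟨hs.1.le, hs.2⟩
    refine (norm_sub_le _ _).trans (add_le_add ?_ ?_)
    · refine (norm_pairing_le _ _).trans ?_
      gcongr
      · exact (norm_nonneg _).trans (hA s)
      · exact hA s
      · exact hL' n
    · refine (norm_pairing_le _ _).trans ?_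
      gcongr
      · exact (norm_nonneg _).trans hXBn
      · exact hL' n
  · refine Filter.Eventually.of_forall fun s _ => ?_
    have := (hlim (NB s)).sub (hlim (XB s))
    rw [hNBe s h hh0, hXBe s h hh0] at this
    simpa only [fun n => hNBe s _ (hφ0 n), fun n => hXBe s _ (hφ0 n)] using this

end Uniqueness

section Uniqueness

variable {m : Plane → ℝ} {N : ℝ → Plane → ℂ} {C : ℝ} {X₀ : ComplexL2} {X : ℝ → ComplexL2}

lemma IsLocalTest.integrable {R : ℝ} {h : Plane → ℂ} (hh : IsLocalTest R h) :
    Integrable h volume := by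
  have h1 : MemLp ((Metric.closedBall (0 : Plane) R).indicator fun _ => (1 : ℂ)) 2 volume :=
    memLp_indicator_const 2 Metric.isClosed_closedBall.measurableSet _
      (Or.inr (isCompact_closedBall (0 : Plane) R).measure_lt_top.ne)
  refine (h1.integrable_mul hh.1).congr (Filter.Eventually.of_forall fun ξ => ?_)
  by_cases hξ : ‖ξ‖ ≤ R
  · simp [hξ]
  · simp [hh.2 ξ (not_le.mp hξ)]

/-- A square integrable majorant of the solution on a ball. -/
def localMajorant (C R T : ℝ) (X₀ : Plane → ℂ) (ξ : Plane) : ℂ :=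
  (‖X₀ ξ‖ : ℂ) + (Metric.closedBall (0 : Plane) R).indicator (fun _ => ((C * R * T : ℝ) : ℂ)) ξ

lemma memLp_localMajorant (C R T : ℝ) {X₀ : Plane → ℂ} (hX₀ : MemLp X₀ 2 volume) :
    MemLp (localMajorant C R T X₀) 2 volume := by
  have h1 : MemLp (fun ξ => (‖X₀ ξ‖ : ℂ)) 2 volume := hX₀.norm.ofReal
  have h2 : MemLp ((Metric.closedBall (0 : Plane) R).indicator
      (fun _ => ((C * R * T : ℝ) : ℂ))) 2 volume :=
    memLp_indicator_const 2 Metric.isClosed_closedBall.measurableSet _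
      (Or.inr (isCompact_closedBall (0 : Plane) R).measure_lt_top.ne)
  exact h1.add h2

lemma norm_duhamel_le_localMajorant {X₀ : Plane → ℂ} (hm0 : ∀ ξ, 0 ≤ m ξ) (hC : 0 ≤ C)
    (hNb : ∀ s ξ, ‖N s ξ‖ ≤ C * ‖ξ‖) {R T t : ℝ} (ht : t ∈ Set.Icc 0 T) {ξ : Plane}
    (hξ : ‖ξ‖ ≤ R) : ‖duhamel m N X₀ t ξ‖ ≤ ‖localMajorant C R T X₀ ξ‖ := by
  refine (norm_duhamel_le hm0 hNb ht.1 ξ).trans ?_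
  rw [localMajorant, Set.indicator_of_mem (by simpa using hξ), ← Complex.ofReal_add,
    Complex.norm_real]
  refine le_trans ?_ (le_abs_self _)
  have := ht.1
  have := ht.2
  have : 0 ≤ R := (norm_nonneg ξ).trans hξ
  gcongr

lemma integrable_forcing_mul (hN : StronglyMeasurable (Function.uncurry N)) (hC : 0 ≤ C)
    (hNb : ∀ s ξ, ‖N s ξ‖ ≤ C * ‖ξ‖) {R : ℝ} {h : Plane → ℂ} (hh : IsLocalTest R h) (t : ℝ) :
    Integrable (fun p : ℝ × Plane => N p.1 p.2 * h p.2)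
      ((volume.restrict (Set.Ioc 0 t)).prod volume) := by
  have h1 : Integrable (fun p : ℝ × Plane => ((C * R : ℝ) : ℂ) * h p.2)
      ((volume.restrict (Set.Ioc 0 t)).prod volume) := (hh.integrable.comp_snd _).const_mul _
  refine h1.mono (hN.aestronglyMeasurable.mul hh.1.1.comp_snd)
    (Filter.Eventually.of_forall fun p => ?_)
  by_cases hξ : ‖p.2‖ ≤ R
  · rw [norm_mul, norm_mul, Complex.norm_real]
    gcongr
    refine (hNb _ _).trans (le_trans ?_ (le_abs_self _))
    gcongr
  · simp [hh.2 p.2 (not_le.mp hξ)]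

lemma integrable_duhamel_mul (hm : Continuous m) (hm0 : ∀ ξ, 0 ≤ m ξ)
    (hN : StronglyMeasurable (Function.uncurry N)) (hC : 0 ≤ C)
    (hNb : ∀ s ξ, ‖N s ξ‖ ≤ C * ‖ξ‖) {R : ℝ} {h : Plane → ℂ} (hh : IsLocalTest R h) (t : ℝ) :
    Integrable (fun p : ℝ × Plane => duhamel m N X₀ p.1 p.2 * h p.2)
      ((volume.restrict (Set.Ioc 0 t)).prod volume) := by
  have h1 : Integrable (fun p : ℝ × Plane => localMajorant C R t X₀ p.2 * h p.2)
      ((volume.restrict (Set.Ioc 0 t)).prod volume) :=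
    ((memLp_localMajorant C R t (Lp.memLp X₀)).integrable_mul hh.1).comp_snd _
  refine h1.mono ((aestronglyMeasurable_duhamel hm hN hNb (Lp.aestronglyMeasurable X₀) _).mul
    hh.1.1.comp_snd) ?_
  have hae : ∀ᵐ p : ℝ × Plane ∂((volume.restrict (Set.Ioc 0 t)).prod volume),
      p.1 ∈ Set.Ioc 0 t :=
    Measure.quasiMeasurePreserving_fst.ae (ae_restrict_mem measurableSet_Ioc)
  filter_upwards [hae] with p hp
  by_cases hξ : ‖p.2‖ ≤ R
  · rw [norm_mul, norm_mul]
    gcongr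
    exact norm_duhamel_le_localMajorant hm0 hC hNb ⟨hp.1.le, hp.2⟩ hξ
  · simp [hh.2 p.2 (not_le.mp hξ)]

lemma integrable_duhamel_apply_mul (hm : Continuous m) (hm0 : ∀ ξ, 0 ≤ m ξ)
    (hN : StronglyMeasurable (Function.uncurry N)) (hC : 0 ≤ C)
    (hNb : ∀ s ξ, ‖N s ξ‖ ≤ C * ‖ξ‖) {R : ℝ} {h : Plane → ℂ} (hh : IsLocalTest R h) {t : ℝ}
    (ht : 0 ≤ t) : Integrable (fun ξ => duhamel m N X₀ t ξ * h ξ) volume := by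
  refine ((memLp_localMajorant C R t (Lp.memLp X₀)).integrable_mul hh.1).mono
    ((aestronglyMeasurable_duhamel_apply hm hN hNb (Lp.aestronglyMeasurable X₀) t).mul hh.1.1)
    (Filter.Eventually.of_forall fun ξ => ?_)
  by_cases hξ : ‖ξ‖ ≤ R
  · rw [norm_mul, Pi.mul_apply, norm_mul]
    gcongr
    exact norm_duhamel_le_localMajorant hm0 hC hNb ⟨ht, le_rfl⟩ hξ
  · simp [hh.2 ξ (not_le.mp hξ)]

/-- Duhamel's formula defines a weak solution. -/
lemma duhamel_equation_local (hm : Continuous m) (hm0 : ∀ ξ, 0 ≤ m ξ)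
    (hN : StronglyMeasurable (Function.uncurry N)) (hC : 0 ≤ C)
    (hNb : ∀ s ξ, ‖N s ξ‖ ≤ C * ‖ξ‖) {R : ℝ} {h : Plane → ℂ} (hh : IsLocalTest R h) {t : ℝ}
    (ht : 0 ≤ t) :
    (∫ ξ, duhamel m N X₀ t ξ * h ξ) - ∫ ξ, X₀ ξ * h ξ =
      (∫ s in (0 : ℝ)..t, ∫ ξ, N s ξ * h ξ) -
        ∫ s in (0 : ℝ)..t, ∫ ξ, duhamel m N X₀ s ξ * (m ξ * h ξ) := by
  have i1 := integrable_forcing_mul hN hC hNb hh t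
  have i2 := integrable_duhamel_mul (X₀ := X₀) hm hm0 hN hC hNb (hh.symbol_mul hm) t
  have e : ∀ ξ, duhamel m N X₀ t ξ * h ξ - X₀ ξ * h ξ =
      ∫ s in (0 : ℝ)..t, (N s ξ * h ξ - duhamel m N X₀ s ξ * (m ξ * h ξ)) := fun ξ => by
    rw [← sub_mul, duhamel_sub_initial hN hNb, ← intervalIntegral.integral_mul_const]
    congr 1
    funext s
    ring
  have i0 : Integrable (fun ξ => X₀ ξ * h ξ) volume := (Lp.memLp X₀).integrable_mul hh.1
  rw [← integral_sub (integrable_duhamel_apply_mul hm hm0 hN hC hNb hh ht) i0]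
  simp only [e, intervalIntegral.integral_of_le ht]
  -- Duhamel's formula solves the ODE for each ξ; Fubini applies because `h` lives on a ball, where
  -- the solution has an `L²` majorant uniform in time.
  rw [integral_integral_swap (f := fun ξ s => N s ξ * h ξ - duhamel m N X₀ s ξ * (m ξ * h ξ))
    (i1.sub i2).swap, ← integral_sub i1.integral_prod_left
    i2.integral_prod_left]
  refine integral_congr_ae ?_
  filter_upwards [i1.prod_right_ae, i2.prod_right_ae] with s h1 h2
  exact integral_sub h1 h2

/-- Uniqueness: a weak solution on the Fourier side is given by Duhamel's formula. -/
theorem IsFourierSolution.ae_eq_duhamel (hX : IsFourierSolution m N X₀ X) (hm : Continuous m)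
    (hm0 : ∀ ξ, 0 ≤ m ξ) (hN : StronglyMeasurable (Function.uncurry N)) (hC : 0 ≤ C)
    (hNb : ∀ s ξ, ‖N s ξ‖ ≤ C * ‖ξ‖) {t : ℝ} (ht : 0 ≤ t) :
    X t =ᵐ[volume] duhamel m N X₀ t := by
  -- Only on balls are `m` bounded and the Duhamel expression known to be square integrable, so
  -- uniqueness is proved ball by ball.
  have hball : ∀ n : ℕ, ∀ᵐ ξ : Plane, ‖ξ‖ ≤ n + 1 → X t ξ = duhamel m N X₀ t ξ := by
    intro n
    set R : ℝ := n + 1 with hRdef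
    have hR : 0 < R := by positivity
    obtain ⟨K, hK0, hK⟩ := exists_bound_on_ball hm R
    obtain ⟨MX, hMX⟩ := hX.locally_bounded t
    have hMX0 : 0 ≤ MX := (norm_nonneg _).trans (hMX t ⟨ht, le_rfl⟩)
    have hG := memLp_localMajorant C R t (Lp.memLp X₀)
    have hp : ∀ h, IsLocalTest R h →
        (∫ ξ, X t ξ * h ξ) - ∫ ξ, duhamel m N X₀ t ξ * h ξ = 0 := by
      intro h hh
      -- The forcing cancels in the difference of the two weak equations, leaving p(h)' = -p(mh)
      -- with |m| ≤ K on the ball.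
      refine eq_zero_of_eq_neg_integral (P := IsLocalTest R)
        (p := fun s h => (∫ ξ, X s ξ * h ξ) - ∫ ξ, duhamel m N X₀ s ξ * h ξ)
        (M := fun h ξ => m ξ * h ξ) (nrm := fun h => (eLpNorm h 2 volume).toReal)
        (K := K) (B := MX + ‖hG.toLp _‖) (T := t) hK0 (by positivity)
        (fun χ hχ => hχ.symbol_mul hm) ?_ ?_ ?_ hh ⟨ht, le_rfl⟩
      · intro χ hχ
        rw [← Lp.norm_toLp _ hχ.1, ← Lp.norm_toLp _ (hχ.symbol_mul hm).1]
        refine Lp.norm_le_mul_norm_of_ae_le_mul ?_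
        filter_upwards [hχ.1.coeFn_toLp, (hχ.symbol_mul hm).1.coeFn_toLp] with ξ h1 h2
        rw [h1, h2]
        by_cases hξ : ‖ξ‖ ≤ R
        · rw [norm_mul, Complex.norm_real]
          gcongr
          exact hK ξ hξ
        · simp [hχ.2 ξ (not_le.mp hξ)]
      · intro χ hχ s hs
        rw [← Lp.norm_toLp _ hχ.1, add_mul]
        refine (norm_sub_le _ _).trans (add_le_add ?_ ?_)
        · rw [← pairing_toLp_right (X s) hχ.1]
          refine (norm_pairing_le _ _).trans ?_
          gcongr
          exact hMX s hs
        · refine le_trans ?_ (norm_integral_norm_mul_le (hG.toLp _) (hχ.1.toLp _))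
          refine (norm_integral_le_integral_norm _).trans ?_
          refine integral_mono_ae
            (integrable_duhamel_apply_mul hm hm0 hN hC hNb hχ hs.1).norm
            ((Lp.memLp _).norm.integrable_mul (Lp.memLp _).norm) ?_
          filter_upwards [hχ.1.coeFn_toLp, hG.coeFn_toLp] with ξ h1 h2
          rw [h1, h2, norm_mul]
          by_cases hξ : ‖ξ‖ ≤ R
          · gcongr
            exact norm_duhamel_le_localMajorant hm0 hC hNb hs hξ
          · simp [hχ.2 ξ (not_le.mp hξ)]
      · intro χ hχ s hs
        have i1 : IntervalIntegrable (fun s => ∫ ξ, N s ξ * χ ξ) volume 0 s := by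
          rw [intervalIntegrable_iff_integrableOn_Ioc_of_le hs.1]
          exact (integrable_forcing_mul hN hC hNb hχ s).integral_prod_left
        have i2 : IntervalIntegrable (fun s => ∫ ξ, duhamel m N X₀ s ξ * (m ξ * χ ξ)) volume 0 s := by
          rw [intervalIntegrable_iff_integrableOn_Ioc_of_le hs.1]
          exact (integrable_duhamel_mul hm hm0 hN hC hNb (hχ.symbol_mul hm) s).integral_prod_left
        have i3 : IntervalIntegrable (fun s => ∫ ξ, X s ξ * (m ξ * χ ξ)) volume 0 s := by
          rw [intervalIntegrable_iff_integrableOn_Ioc_of_le hs.1]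
          refine Integrable.of_bound (hX.aestronglyMeasurable_integral (hχ.symbol_mul hm).1 s)
            (MX * ‖(hχ.symbol_mul hm).1.toLp _‖) ?_
          filter_upwards [ae_restrict_mem measurableSet_Ioc] with r hr
          rw [← pairing_toLp_right (X r) (hχ.symbol_mul hm).1]
          refine (norm_pairing_le _ _).trans ?_
          gcongr
          exact hMX r ⟨hr.1.le, hr.2.trans hs.2⟩
        have e1 := hX.equation_local hm hN hC hNb hR hχ hs.1
        have e2 := duhamel_equation_local (X₀ := X₀) hm hm0 hN hC hNb hχ hs.1
        rw [intervalIntegral.integral_sub i1 i3] at e1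
        rw [intervalIntegral.integral_sub i3 i2]
        linear_combination e1 - e2
    -- test with the conjugate of the difference
    let d : Plane → ℂ := fun ξ => X t ξ - duhamel m N X₀ t ξ
    let h : Plane → ℂ := (Metric.closedBall (0 : Plane) R).indicator fun ξ => star (d ξ)
    have hdm : AEStronglyMeasurable d volume := (Lp.aestronglyMeasurable (X t)).sub
      (aestronglyMeasurable_duhamel_apply hm hN hNb (Lp.aestronglyMeasurable X₀) t)
    have hh : IsLocalTest R h := by
      refine ⟨MemLp.of_le ((Lp.memLp (X t)).norm.add hG.norm)
        (hdm.star.indicator Metric.isClosed_closedBall.measurableSet)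
        (Filter.Eventually.of_forall fun ξ => ?_), fun ξ hξ => ?_⟩
      · refine le_trans ?_ (le_abs_self _)
        by_cases hξ : ‖ξ‖ ≤ R
        · simp only [h]
          rw [Set.indicator_of_mem (by simpa using hξ), norm_star]
          refine (norm_sub_le _ _).trans (add_le_add le_rfl ?_)
          exact norm_duhamel_le_localMajorant hm0 hC hNb ⟨ht, le_rfl⟩ hξ
        · simp only [h]
          rw [Set.indicator_of_notMem (by simpa using hξ), norm_zero]
          exact add_nonneg (norm_nonneg _) (norm_nonneg _)
      · exact Set.indicator_of_notMem (by simpa using hξ) _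
    have iX : Integrable (fun ξ => X t ξ * h ξ) volume := (Lp.memLp (X t)).integrable_mul hh.1
    have iV := integrable_duhamel_apply_mul (X₀ := X₀) hm hm0 hN hC hNb hh ht
    have hz := hp h hh
    rw [← integral_sub iX iV] at hz
    have e : ∀ ξ, X t ξ * h ξ - duhamel m N X₀ t ξ * h ξ = ((‖h ξ‖ ^ 2 : ℝ) : ℂ) := fun ξ => by
      rw [← sub_mul]
      by_cases hξ : ‖ξ‖ ≤ R
      · have : h ξ = star (d ξ) := Set.indicator_of_mem (by simpa using hξ) _
        rw [this, norm_star]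
        push_cast
        exact Complex.mul_conj' _
      · simp [hh.2 ξ (not_le.mp hξ)]
    simp only [e] at hz
    rw [integral_complex_ofReal, Complex.ofReal_eq_zero,
      integral_eq_zero_iff_of_nonneg (fun ξ => sq_nonneg _) hh.1.norm.integrable_sq] at hz
    filter_upwards [hz] with ξ hξ hξR
    have h1 : h ξ = 0 := by simpa using hξ
    have h2 : h ξ = star (d ξ) := Set.indicator_of_mem (by simpa using hξR) _
    rw [h2, star_eq_zero] at h1
    exact sub_eq_zero.mp h1
  filter_upwards [ae_all_iff.mpr hball] with ξ hξ
  obtain ⟨n, hn⟩ := exists_nat_ge ‖ξ‖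
  exact hξ n (by linarith)

end Uniqueness

/-! ### Energy balance of the Duhamel part -/

lemma ofReal_integral_le_lintegral {Ω : Type*} {_ : MeasurableSpace Ω} {μ : Measure Ω}
    {f : Ω → ℝ} (hf : Integrable f μ) :
    ENNReal.ofReal (∫ x, f x ∂μ) ≤ ∫⁻ x, ENNReal.ofReal (f x) ∂μ := by
  have h1 : ∫ x, f x ∂μ ≤ ∫ x, max (f x) 0 ∂μ :=
    integral_mono hf hf.pos_part fun x => le_max_left _ _
  refine (ENNReal.ofReal_le_ofReal h1).trans ?_
  rw [ofReal_integral_eq_lintegral_ofReal hf.pos_part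
    (Filter.Eventually.of_forall fun x => le_max_right _ _)]
  refine lintegral_mono fun x => ?_
  simp only
  rcases le_total (f x) 0 with h | h
  · simp [h]
  · simp [h]

/-- When `b` is negative, truncating it to 0 only strengthens the hypothesis. -/
lemma add_le_of_ofReal_add_le {a b c : ℝ} (ha : 0 ≤ a) (hc : 0 ≤ c)
    (h : ENNReal.ofReal a + 2 * ENNReal.ofReal b ≤ ENNReal.ofReal c) : a + 2 * b ≤ c := by
  rcases le_total b 0 with hb | hb
  · have := (ENNReal.ofReal_le_ofReal_iff hc).mp ((self_le_add_right _ _).trans h)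
    linarith
  · rw [← ENNReal.ofReal_ofNat 2, ← ENNReal.ofReal_mul (by norm_num),
      ← ENNReal.ofReal_add ha (by positivity), ENNReal.ofReal_le_ofReal_iff hc] at h
    exact h

section Energy

variable {m : Plane → ℝ} {N : ℝ → Plane → ℂ} {C : ℝ} {X₀ : Plane → ℂ}

/-- The Fourier side of the solution of the linear equation. -/
def linearFlow (m : Plane → ℝ) (X₀ : Plane → ℂ) (t : ℝ) (ξ : Plane) : ℂ :=
  (Real.exp (-(m ξ * t)) : ℂ) * X₀ ξ

/-- The difference `|V|² - |W|²` for `V = e^{-tm} X₀ + W`. -/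
def energyGap (m : Plane → ℝ) (N : ℝ → Plane → ℂ) (X₀ : Plane → ℂ) (t : ℝ) (ξ : Plane) : ℝ :=
  ‖duhamel m N X₀ t ξ‖ ^ 2 - ‖duhamelIntegral m N t ξ‖ ^ 2

/-- The density of the work of the forcing on the linear flow. -/
def workDensity (m : Plane → ℝ) (N : ℝ → Plane → ℂ) (X₀ : Plane → ℂ) (t : ℝ) (ξ : Plane) : ℝ :=
  (star (linearFlow m X₀ t ξ) * N t ξ).re

lemma norm_add_sq_sub_norm_sq (z w : ℂ) : ‖z + w‖ ^ 2 - ‖w‖ ^ 2 = (star z * (z + 2 * w)).re := by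
  rw [← Complex.normSq_eq_norm_sq, ← Complex.normSq_eq_norm_sq, Complex.normSq_apply,
    Complex.normSq_apply]
  simp
  ring

/-- The |W|² terms cancel, so the gap is affine in the forcing. It is e^{-2mt} times a primitive,
the form required by `exp_mul_primitive_sub` with rate 2m. -/
lemma energyGap_eq (t : ℝ) (ξ : Plane) :
    energyGap m N X₀ t ξ = (star (X₀ ξ) * ((Real.exp (-(2 * m ξ * t)) : ℂ) *
      (X₀ ξ + ∫ σ in (0 : ℝ)..t, 2 * ((Real.exp (m ξ * σ) : ℂ) * N σ ξ)))).re := by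
  rw [energyGap, duhamel, norm_add_sq_sub_norm_sq, duhamelIntegral,
    intervalIntegral.integral_const_mul]
  congr 1
  have e : (Real.exp (-(2 * m ξ * t)) : ℂ) = Real.exp (-(m ξ * t)) * Real.exp (-(m ξ * t)) := by
    rw [← Complex.ofReal_mul, ← Real.exp_add]
    congr 2
    ring
  rw [e, star_mul, Complex.star_def, Complex.conj_ofReal]
  ring

/-- Evolution of the energy gap. -/
lemma energyGap_sub (hN : StronglyMeasurable (Function.uncurry N))
    (hNb : ∀ s ξ, ‖N s ξ‖ ≤ C * ‖ξ‖) (s t : ℝ) (ξ : Plane) :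
    energyGap m N X₀ t ξ - energyGap m N X₀ s ξ =
      ∫ σ in s..t, (2 * workDensity m N X₀ σ ξ - 2 * (m ξ * energyGap m N X₀ σ ξ)) := by
  have hk : ∀ x y : ℝ, IntervalIntegrable
      (fun σ => 2 * ((Real.exp (m ξ * σ) : ℂ) * N σ ξ)) volume x y := fun x y =>
    (intervalIntegrable_exp_mul_forcing hN hNb ξ x y).const_mul 2
  have hI : Continuous fun σ => ∫ r in (0 : ℝ)..σ, 2 * ((Real.exp (m ξ * r) : ℂ) * N r ξ) :=
    intervalIntegral.continuous_primitive hk 0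
  have h := congrArg (fun z => (star (X₀ ξ) * z).re) (exp_mul_primitive_sub (2 * m ξ) (X₀ ξ) hk s t)
  simp only [mul_sub, Complex.sub_re] at h
  rw [energyGap_eq, energyGap_eq, h, ← intervalIntegral.integral_const_mul, ← Complex.reCLM_apply,
    ← Complex.reCLM.intervalIntegral_comp_comm]
  · refine intervalIntegral.integral_congr fun σ _ => ?_
    simp only [Complex.reCLM_apply]
    rw [energyGap_eq, workDensity, linearFlow]
    have e : (Real.exp (-(2 * m ξ * σ)) : ℂ) * Real.exp (m ξ * σ) = Real.exp (-(m ξ * σ)) := by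
      rw [← Complex.ofReal_mul, ← Real.exp_add]
      congr 2
      ring
    rw [star_mul, Complex.star_def, Complex.conj_ofReal, ← e, mul_sub,
      Complex.sub_re]
    congr 1
    · rw [← Complex.re_ofReal_mul]
      congr 1
      push_cast
      ring
    · rw [← Complex.re_ofReal_mul, ← Complex.re_ofReal_mul]
      congr 1
      push_cast
      ring
  · refine IntervalIntegrable.const_mul (IntervalIntegrable.sub ?_ ?_) _
    · exact (hk s t).continuousOn_mul
        (by fun_prop : Continuous fun σ : ℝ => (Real.exp (-(2 * m ξ * σ)) : ℂ)).continuousOn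
    · exact Continuous.intervalIntegrable (by fun_prop) _ _

lemma norm_linearFlow (t : ℝ) (ξ : Plane) :
    ‖linearFlow m X₀ t ξ‖ = Real.exp (-(m ξ * t)) * ‖X₀ ξ‖ := by
  rw [linearFlow, norm_mul, Complex.norm_real, Real.norm_of_nonneg (Real.exp_pos _).le]

lemma norm_linearFlow_le (hm0 : ∀ ξ, 0 ≤ m ξ) {s t : ℝ} (hst : s ≤ t) (ξ : Plane) :
    ‖linearFlow m X₀ t ξ‖ ≤ Real.exp (-(m ξ * s)) * ‖X₀ ξ‖ := by
  rw [norm_linearFlow]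
  have := hm0 ξ
  gcongr

lemma abs_workDensity_le (hm0 : ∀ ξ, 0 ≤ m ξ) (hNb : ∀ s ξ, ‖N s ξ‖ ≤ C * ‖ξ‖) {s t : ℝ}
    (hst : s ≤ t) (ξ : Plane) :
    |workDensity m N X₀ t ξ| ≤ C * (‖ξ‖ * Real.exp (-(m ξ * s)) * ‖X₀ ξ‖) := by
  refine (Complex.abs_re_le_norm _).trans ?_
  rw [norm_mul, norm_star]
  calc _ ≤ Real.exp (-(m ξ * s)) * ‖X₀ ξ‖ * (C * ‖ξ‖) := by
        gcongr
        · exact norm_linearFlow_le hm0 hst ξ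
        · exact hNb t ξ
    _ = _ := by ring

lemma abs_energyGap_le (hm0 : ∀ ξ, 0 ≤ m ξ) (hNb : ∀ s ξ, ‖N s ξ‖ ≤ C * ‖ξ‖)
    {σ : ℝ} (hσ : 0 ≤ σ) (ξ : Plane) :
    |energyGap m N X₀ σ ξ| ≤
      Real.exp (-(m ξ * σ)) * ‖X₀ ξ‖ * (‖X₀ ξ‖ + 2 * (C * ‖ξ‖ * σ)) := by
  have h1 : energyGap m N X₀ σ ξ = (star (linearFlow m X₀ σ ξ) *
      (linearFlow m X₀ σ ξ + 2 * duhamelIntegral m N σ ξ)).re := by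
    rw [energyGap, duhamel, norm_add_sq_sub_norm_sq]
    rfl
  rw [h1]
  refine (Complex.abs_re_le_norm _).trans ?_
  rw [norm_mul, norm_star, norm_linearFlow]
  gcongr
  refine (norm_add_le _ _).trans (add_le_add ?_ ?_)
  · simpa using norm_linearFlow_le (X₀ := X₀) hm0 hσ ξ
  · rw [norm_mul]
    simp only [Complex.norm_ofNat]
    gcongr
    exact norm_duhamelIntegral_le hm0 hNb hσ ξ

/-- For σ ≥ s, e^{-mσ} is at most the product of two copies of e^{-ms/2}. One absorbs `m`, since m
e^{-ms/2} ≤ 2/s; the other keeps ‖ξ‖e^{-ms/2} square integrable. The majorant is uniform in σ, as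
Fubini on [s,t] requires, and this is why s > 0. -/
lemma mul_abs_energyGap_le (hm0 : ∀ ξ, 0 ≤ m ξ) (hC : 0 ≤ C) (hNb : ∀ s ξ, ‖N s ξ‖ ≤ C * ‖ξ‖)
    {s t σ : ℝ} (hs : 0 < s) (hsσ : s ≤ σ) (hσt : σ ≤ t) (ξ : Plane) :
    |m ξ * energyGap m N X₀ σ ξ| ≤
      2 / s * (‖X₀ ξ‖ ^ 2 + 2 * C * t * (‖ξ‖ * Real.exp (-(m ξ * (s / 2))) * ‖X₀ ξ‖)) := by
  have hm := hm0 ξ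
  have ht : 0 ≤ t := by linarith
  rw [abs_mul, abs_of_nonneg hm]
  have h1 : m ξ * Real.exp (-(m ξ * (s / 2))) ≤ 2 / s := by
    have h2 : m ξ * (s / 2) ≤ Real.exp (m ξ * (s / 2)) := by
      linarith [Real.add_one_le_exp (m ξ * (s / 2))]
    rw [Real.exp_neg, ← div_eq_mul_inv, div_le_div_iff₀ (Real.exp_pos _) hs]
    linarith
  have h3 : Real.exp (-(m ξ * σ)) ≤ Real.exp (-(m ξ * (s / 2))) * Real.exp (-(m ξ * (s / 2))) := by
    rw [← Real.exp_add]
    gcongr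
    nlinarith
  have h4 : Real.exp (-(m ξ * (s / 2))) ≤ 1 :=
    Real.exp_le_one_iff.mpr (neg_nonpos.mpr (by positivity))
  calc m ξ * |energyGap m N X₀ σ ξ|
      ≤ m ξ * ((Real.exp (-(m ξ * (s / 2))) * Real.exp (-(m ξ * (s / 2)))) * ‖X₀ ξ‖ *
          (‖X₀ ξ‖ + 2 * (C * ‖ξ‖ * t))) := by
        gcongr
        have hσ0 : 0 ≤ σ := by linarith
        have : 0 ≤ ‖X₀ ξ‖ + 2 * (C * ‖ξ‖ * σ) := by positivity
        refine (abs_energyGap_le hm0 hNb (hs.le.trans hsσ) ξ).trans ?_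
        gcongr
    _ = (m ξ * Real.exp (-(m ξ * (s / 2)))) * (Real.exp (-(m ξ * (s / 2))) * ‖X₀ ξ‖ ^ 2 +
          2 * C * t * (‖ξ‖ * Real.exp (-(m ξ * (s / 2))) * ‖X₀ ξ‖)) := by ring
    _ ≤ 2 / s * (1 * ‖X₀ ξ‖ ^ 2 +
          2 * C * t * (‖ξ‖ * Real.exp (-(m ξ * (s / 2))) * ‖X₀ ξ‖)) := by gcongr
    _ = _ := by rw [one_mul]

/-! #### Integrability -/

lemma memLp_norm_mul_exp (hm : Continuous m) {τ : ℝ}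
    (hJ : Integrable (fun ξ : Plane => ‖ξ‖ ^ 2 * Real.exp (-(2 * τ * m ξ)))) :
    MemLp (fun ξ : Plane => ‖ξ‖ * Real.exp (-(m ξ * τ))) 2 volume := by
  rw [memLp_two_iff_integrable_sq (by fun_prop)]
  refine hJ.congr (Filter.Eventually.of_forall fun ξ => ?_)
  simp only
  rw [mul_pow, ← Real.exp_nat_mul]
  congr 2
  push_cast
  ring

lemma integrable_norm_mul_exp_mul (hm : Continuous m) {τ : ℝ}
    (hJ : Integrable (fun ξ : Plane => ‖ξ‖ ^ 2 * Real.exp (-(2 * τ * m ξ))))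
    (hX : MemLp X₀ 2 volume) :
    Integrable (fun ξ : Plane => ‖ξ‖ * Real.exp (-(m ξ * τ)) * ‖X₀ ξ‖) :=
  (memLp_norm_mul_exp hm hJ).integrable_mul hX.norm

lemma integral_norm_mul_exp_mul_le (hm : Continuous m) {τ : ℝ}
    (hJ : Integrable (fun ξ : Plane => ‖ξ‖ ^ 2 * Real.exp (-(2 * τ * m ξ))))
    (hX : MemLp X₀ 2 volume) :
    ∫ ξ : Plane, ‖ξ‖ * Real.exp (-(m ξ * τ)) * ‖X₀ ξ‖ ≤
      √(∫ ξ : Plane, ‖ξ‖ ^ 2 * Real.exp (-(2 * τ * m ξ))) * √(∫ ξ, ‖X₀ ξ‖ ^ 2) := by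
  have h := integral_mul_le_Lp_mul_Lq_of_nonneg (μ := (volume : Measure Plane))
    (p := 2) (q := 2) (f := fun ξ : Plane => ‖ξ‖ * Real.exp (-(m ξ * τ)))
    (g := fun ξ => ‖X₀ ξ‖) (by constructor <;> norm_num)
    (Filter.Eventually.of_forall fun ξ => by positivity)
    (Filter.Eventually.of_forall fun ξ => by positivity)
    (by simpa using memLp_norm_mul_exp hm hJ) (by simpa using hX.norm)
  refine h.trans (le_of_eq ?_)
  rw [Real.sqrt_eq_rpow, Real.sqrt_eq_rpow]
  simp only [Real.rpow_two, mul_pow, ← Real.exp_nat_mul]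
  congr! 6 with ξ
  push_cast
  ring_nf

end Energy

section Energy

variable {m : Plane → ℝ} {N : ℝ → Plane → ℂ} {C : ℝ} {X₀ : Plane → ℂ}

lemma memLp_linearFlow (hm : Continuous m) (hm0 : ∀ ξ, 0 ≤ m ξ) (hX : MemLp X₀ 2 volume)
    {t : ℝ} (ht : 0 ≤ t) : MemLp (linearFlow m X₀ t) 2 volume := by
  refine hX.of_le (AEStronglyMeasurable.mul ?_ hX.1) (Filter.Eventually.of_forall fun ξ => ?_)
  · exact (by fun_prop : Continuous fun ξ : Plane =>
      (Real.exp (-(m ξ * t)) : ℂ)).aestronglyMeasurable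
  · simpa using norm_linearFlow_le (X₀ := X₀) hm0 ht ξ

lemma memLp_duhamelIntegral (hm : Continuous m) (hm0 : ∀ ξ, 0 ≤ m ξ) (hX : MemLp X₀ 2 volume)
    {t : ℝ} (ht : 0 ≤ t) (hV : MemLp (duhamel m N X₀ t) 2 volume) :
    MemLp (duhamelIntegral m N t) 2 volume := by
  refine (hV.sub (memLp_linearFlow hm hm0 hX ht)).ae_eq (Filter.Eventually.of_forall fun ξ => ?_)
  simp [duhamel, linearFlow]

lemma aestronglyMeasurable_workDensity (hm : Continuous m)
    (hN : StronglyMeasurable (Function.uncurry N)) (hX : AEStronglyMeasurable X₀ volume)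
    (μ : Measure ℝ) [SFinite μ] :
    AEStronglyMeasurable (fun p : ℝ × Plane => workDensity m N X₀ p.1 p.2) (μ.prod volume) := by
  have h1 : AEStronglyMeasurable (fun p : ℝ × Plane => linearFlow m X₀ p.1 p.2)
      (μ.prod volume) :=
    (by fun_prop : Continuous fun p : ℝ × Plane =>
      (Real.exp (-(m p.2 * p.1)) : ℂ)).aestronglyMeasurable.mul hX.comp_snd
  exact Complex.continuous_re.comp_aestronglyMeasurable (h1.star.mul hN.aestronglyMeasurable)

lemma aestronglyMeasurable_energyGap (hm : Continuous m)
    (hN : StronglyMeasurable (Function.uncurry N)) (hNb : ∀ s ξ, ‖N s ξ‖ ≤ C * ‖ξ‖)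
    (hX : AEStronglyMeasurable X₀ volume) (μ : Measure ℝ) [SFinite μ] :
    AEStronglyMeasurable (fun p : ℝ × Plane => m p.2 * energyGap m N X₀ p.1 p.2)
      (μ.prod volume) :=
  (by fun_prop : Continuous fun p : ℝ × Plane => m p.2).aestronglyMeasurable.mul
    (((aestronglyMeasurable_duhamel hm hN hNb hX μ).norm.pow 2).sub
      ((stronglyMeasurable_duhamelIntegral hm hN hNb).aestronglyMeasurable.norm.pow 2))

lemma integrable_workDensity (hm : Continuous m) (hm0 : ∀ ξ, 0 ≤ m ξ)
    (hN : StronglyMeasurable (Function.uncurry N)) (hNb : ∀ s ξ, ‖N s ξ‖ ≤ C * ‖ξ‖)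
    (hX : MemLp X₀ 2 volume) {s : ℝ} (t : ℝ)
    (hJ : Integrable (fun ξ : Plane => ‖ξ‖ ^ 2 * Real.exp (-(2 * s * m ξ)))) :
    Integrable (fun p : ℝ × Plane => workDensity m N X₀ p.1 p.2)
      ((volume.restrict (Set.Ioc s t)).prod volume) := by
  refine (((integrable_norm_mul_exp_mul hm hJ hX).const_mul C).comp_snd
    (volume.restrict (Set.Ioc s t))).mono'
    (aestronglyMeasurable_workDensity hm hN hX.1 _) ?_
  filter_upwards [Measure.quasiMeasurePreserving_fst.ae
    (ae_restrict_mem (μ := volume) (measurableSet_Ioc (a := s) (b := t)))] with p hp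
  exact abs_workDensity_le hm0 hNb hp.1.le p.2

lemma integrable_mul_energyGap (hm : Continuous m) (hm0 : ∀ ξ, 0 ≤ m ξ)
    (hN : StronglyMeasurable (Function.uncurry N)) (hC : 0 ≤ C)
    (hNb : ∀ s ξ, ‖N s ξ‖ ≤ C * ‖ξ‖) (hX : MemLp X₀ 2 volume) {s : ℝ} (hs : 0 < s) (t : ℝ)
    (hJ : Integrable (fun ξ : Plane => ‖ξ‖ ^ 2 * Real.exp (-(2 * (s / 2) * m ξ)))) :
    Integrable (fun p : ℝ × Plane => m p.2 * energyGap m N X₀ p.1 p.2)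
      ((volume.restrict (Set.Ioc s t)).prod volume) := by
  have h1 : Integrable (fun ξ : Plane => 2 / s * (‖X₀ ξ‖ ^ 2 +
      2 * C * t * (‖ξ‖ * Real.exp (-(m ξ * (s / 2))) * ‖X₀ ξ‖))) :=
    (hX.norm.integrable_sq.add ((integrable_norm_mul_exp_mul hm hJ hX).const_mul _)).const_mul _
  refine (h1.comp_snd (volume.restrict (Set.Ioc s t))).mono'
    (aestronglyMeasurable_energyGap hm hN hNb hX.1 _) ?_
  filter_upwards [Measure.quasiMeasurePreserving_fst.ae
    (ae_restrict_mem (μ := volume) (measurableSet_Ioc (a := s) (b := t)))] with p hp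
  exact mul_abs_energyGap_le hm0 hC hNb hs hp.1.le hp.2 p.2

/-- Comparison of the energies of `W` at two times, given the energy inequality for `V`. -/
lemma energy_comparison (hm : Continuous m) (hm0 : ∀ ξ, 0 ≤ m ξ)
    (hN : StronglyMeasurable (Function.uncurry N)) (hC : 0 ≤ C)
    (hNb : ∀ s ξ, ‖N s ξ‖ ≤ C * ‖ξ‖) (hX : MemLp X₀ 2 volume)
    (hJ : ∀ τ : ℝ, 0 < τ → Integrable (fun ξ : Plane => ‖ξ‖ ^ 2 * Real.exp (-(2 * τ * m ξ))))
    (hV : ∀ t, 0 ≤ t → MemLp (duhamel m N X₀ t) 2 volume) {s t : ℝ} (hs : 0 < s) (hst : s ≤ t)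
    (hE : ENNReal.ofReal (∫ ξ, ‖duhamel m N X₀ t ξ‖ ^ 2) +
      2 * ∫⁻ τ in Set.Ioc s t, ∫⁻ ξ, ENNReal.ofReal (m ξ * ‖duhamel m N X₀ τ ξ‖ ^ 2) ≤
        ENNReal.ofReal (∫ ξ, ‖duhamel m N X₀ s ξ‖ ^ 2)) {c : ℝ}
    -- The dissipation of W enters through an integrable minorant `l`, so that integrability of
    -- m|W|² need not be known.
    (hc : ∀ᵐ τ ∂(volume.restrict (Set.Ioc s t)), ∃ l : Plane → ℝ, Integrable l ∧
      (∀ ξ, l ξ ≤ m ξ * ‖duhamelIntegral m N τ ξ‖ ^ 2) ∧ c ≤ ∫ ξ, l ξ) :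
    (∫ ξ, ‖duhamelIntegral m N t ξ‖ ^ 2) + 2 * (c * (t - s)) ≤
      (∫ ξ, ‖duhamelIntegral m N s ξ‖ ^ 2) +
        2 * ((t - s) * (C * (√(∫ ξ : Plane, ‖ξ‖ ^ 2 * Real.exp (-(2 * s * m ξ))) *
          √(∫ ξ, ‖X₀ ξ‖ ^ 2)))) := by
  have ht : 0 < t := hs.trans_le hst
  have iW := integrable_workDensity hm hm0 hN hNb hX t (hJ s hs)
  have iG := integrable_mul_energyGap hm hm0 hN hC hNb hX hs t (hJ (s / 2) (by positivity))
  have iVsq : ∀ r, 0 < r → Integrable (fun ξ => ‖duhamel m N X₀ r ξ‖ ^ 2) volume :=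
    fun r hr => (hV r hr.le).norm.integrable_sq
  have iDsq : ∀ r, 0 < r → Integrable (fun ξ => ‖duhamelIntegral m N r ξ‖ ^ 2) volume :=
    fun r hr => (memLp_duhamelIntegral hm hm0 hX hr.le (hV r hr.le)).norm.integrable_sq
  have iGap : ∀ r, 0 < r → Integrable
      (fun ξ => ‖duhamel m N X₀ r ξ‖ ^ 2 - ‖duhamelIntegral m N r ξ‖ ^ 2) volume :=
    fun r hr => (iVsq r hr).sub (iDsq r hr)
  -- the dissipation is bounded below
  have hdiss : ENNReal.ofReal ((∫ τ in Set.Ioc s t, ∫ ξ, m ξ * energyGap m N X₀ τ ξ) +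
      c * (t - s)) ≤
      ∫⁻ τ in Set.Ioc s t, ∫⁻ ξ, ENNReal.ofReal (m ξ * ‖duhamel m N X₀ τ ξ‖ ^ 2) := by
    have e1 : (∫ τ in Set.Ioc s t, ∫ ξ, m ξ * energyGap m N X₀ τ ξ) + c * (t - s) =
        ∫ τ in Set.Ioc s t, ((∫ ξ, m ξ * energyGap m N X₀ τ ξ) + c) := by
      rw [integral_add iG.integral_prod_left (integrable_const c)]
      simp [hst, mul_comm]
    rw [e1]
    refine (ofReal_integral_le_lintegral
      (iG.integral_prod_left.add (integrable_const c))).trans ?_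
    refine lintegral_mono_ae ?_
    filter_upwards [hc, iG.prod_right_ae] with τ hτ hgap
    obtain ⟨l, hl, hlW, hlc⟩ := hτ
    calc ENNReal.ofReal ((∫ ξ, m ξ * energyGap m N X₀ τ ξ) + c)
        ≤ ENNReal.ofReal (∫ ξ, (m ξ * energyGap m N X₀ τ ξ + l ξ)) := by
          rw [integral_add hgap hl]
          gcongr
      _ ≤ ∫⁻ ξ, ENNReal.ofReal (m ξ * energyGap m N X₀ τ ξ + l ξ) :=
          ofReal_integral_le_lintegral (hgap.add hl)
      _ ≤ _ := by
          refine lintegral_mono fun ξ => ENNReal.ofReal_le_ofReal ?_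
          have := hlW ξ
          rw [energyGap]
          linarith
  have hE' := add_le_of_ofReal_add_le (integral_nonneg fun ξ => sq_nonneg _)
    (integral_nonneg fun ξ => sq_nonneg _)
    ((add_le_add le_rfl (mul_le_mul_right hdiss 2)).trans hE)
  -- evolution of the energy gap
  have hgap : ((∫ ξ, ‖duhamel m N X₀ t ξ‖ ^ 2) - ∫ ξ, ‖duhamelIntegral m N t ξ‖ ^ 2) -
      ((∫ ξ, ‖duhamel m N X₀ s ξ‖ ^ 2) - ∫ ξ, ‖duhamelIntegral m N s ξ‖ ^ 2) =
      2 * (∫ τ in Set.Ioc s t, ∫ ξ, workDensity m N X₀ τ ξ) -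
        2 * ∫ τ in Set.Ioc s t, ∫ ξ, m ξ * energyGap m N X₀ τ ξ := by
    rw [← integral_sub (iVsq t ht) (iDsq t ht), ← integral_sub (iVsq s hs) (iDsq s hs),
      ← integral_sub (iGap t ht) (iGap s hs)]
    have e2 : ∀ ξ, (‖duhamel m N X₀ t ξ‖ ^ 2 - ‖duhamelIntegral m N t ξ‖ ^ 2) -
        (‖duhamel m N X₀ s ξ‖ ^ 2 - ‖duhamelIntegral m N s ξ‖ ^ 2) =
        ∫ σ in Set.Ioc s t, (2 * workDensity m N X₀ σ ξ - 2 * (m ξ * energyGap m N X₀ σ ξ)) :=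
      fun ξ => by
        rw [← intervalIntegral.integral_of_le hst]
        exact energyGap_sub hN hNb s t ξ
    simp only [e2]
    rw [integral_integral_swap (f := fun ξ σ => 2 * workDensity m N X₀ σ ξ -
      2 * (m ξ * energyGap m N X₀ σ ξ)) ((iW.const_mul 2).sub (iG.const_mul 2)).swap,
      ← integral_const_mul, ← integral_const_mul,
      ← integral_sub (iW.integral_prod_left.const_mul 2) (iG.integral_prod_left.const_mul 2)]
    refine integral_congr_ae ?_
    filter_upwards [iW.prod_right_ae, iG.prod_right_ae] with σ h1 h2
    rw [integral_sub (h1.const_mul 2) (h2.const_mul 2), integral_const_mul, integral_const_mul]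
  -- the work is small
  have hwork : |∫ τ in Set.Ioc s t, ∫ ξ, workDensity m N X₀ τ ξ| ≤
      (t - s) * (C * (√(∫ ξ : Plane, ‖ξ‖ ^ 2 * Real.exp (-(2 * s * m ξ))) *
          √(∫ ξ, ‖X₀ ξ‖ ^ 2))) := by
    have h1 := norm_setIntegral_le_of_norm_le_const (μ := (volume : Measure ℝ))
      (s := Set.Ioc s t) (f := fun τ => ∫ ξ, workDensity m N X₀ τ ξ)
      (C := C * (√(∫ ξ : Plane, ‖ξ‖ ^ 2 * Real.exp (-(2 * s * m ξ))) * √(∫ ξ, ‖X₀ ξ‖ ^ 2)))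
      (by simp) (fun τ hτ => by
        calc ‖∫ ξ, workDensity m N X₀ τ ξ‖
            ≤ ∫ ξ, C * (‖ξ‖ * Real.exp (-(m ξ * s)) * ‖X₀ ξ‖) :=
              norm_integral_le_of_norm_le ((integrable_norm_mul_exp_mul hm (hJ s hs) hX).const_mul C)
                (Filter.Eventually.of_forall fun ξ => abs_workDensity_le hm0 hNb hτ.1.le ξ)
          _ ≤ _ := by
              rw [integral_const_mul]
              gcongr
              exact integral_norm_mul_exp_mul_le hm (hJ s hs) hX)
    rw [Real.norm_eq_abs] at h1
    refine h1.trans (le_of_eq ?_)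
    simp [hst, mul_comm]
  -- The term ∫∫ m (|V|² - |W|²) cancels between `hE'` and `hgap`; what remains is minus twice the
  -- work.
  have := neg_le_of_abs_le hwork
  linarith

/-- Low frequencies of `W` are controlled by Duhamel's formula. -/
lemma exists_lower_bound_dissipation (hm0 : ∀ ξ, 0 ≤ m ξ)
    (hNb : ∀ s ξ, ‖N s ξ‖ ≤ C * ‖ξ‖) {τ ρ : ℝ} (hτ : 0 ≤ τ) (hρ : 0 < ρ)
    (hJ : Integrable (fun ξ : Plane => ‖ξ‖ ^ 2 * Real.exp (-(2 * (1 / ρ) * m ξ))))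
    (hW : MemLp (duhamelIntegral m N τ) 2 volume) :
    ∃ l : Plane → ℝ, Integrable l ∧ (∀ ξ, l ξ ≤ m ξ * ‖duhamelIntegral m N τ ξ‖ ^ 2) ∧
      ρ * ((∫ ξ, ‖duhamelIntegral m N τ ξ‖ ^ 2) - (C * τ) ^ 2 * Real.exp 2 *
        ∫ ξ : Plane, ‖ξ‖ ^ 2 * Real.exp (-(2 * (1 / ρ) * m ξ))) ≤ ∫ ξ, l ξ := by
  have iW := hW.norm.integrable_sq
  -- Where m ≥ ρ this is at most ρ|W|². Where m ≤ ρ it is nonpositive, because |W|² ≤ (Cτ|ξ|)² and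
  -- e²e^{-2m/ρ} ≥ 1. The factor e² thus replaces the sharp cutoff {m ≤ ρ} by a smooth weight whose
  -- integral is already estimated.
  refine ⟨fun ξ => ρ * (‖duhamelIntegral m N τ ξ‖ ^ 2 - (C * τ) ^ 2 * Real.exp 2 *
    (‖ξ‖ ^ 2 * Real.exp (-(2 * (1 / ρ) * m ξ)))), (iW.sub (hJ.const_mul _)).const_mul _,
    fun ξ => ?_, ?_⟩
  · have hm := hm0 ξ
    rcases le_total ρ (m ξ) with h | h
    · have h1 : 0 ≤ (C * τ) ^ 2 * Real.exp 2 *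
        (‖ξ‖ ^ 2 * Real.exp (-(2 * (1 / ρ) * m ξ))) := by positivity
      have h2 : ρ * ‖duhamelIntegral m N τ ξ‖ ^ 2 ≤ m ξ * ‖duhamelIntegral m N τ ξ‖ ^ 2 := by
        gcongr
      nlinarith
    · have h1 : ‖duhamelIntegral m N τ ξ‖ ^ 2 ≤ (C * ‖ξ‖ * τ) ^ 2 := by
        gcongr
        exact norm_duhamelIntegral_le hm0 hNb hτ ξ
      have h2 : 1 ≤ Real.exp 2 * Real.exp (-(2 * (1 / ρ) * m ξ)) := by
        rw [← Real.exp_add, Real.one_le_exp_iff]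
        have : 1 / ρ * m ξ ≤ 1 := by
          rw [one_div, inv_mul_le_iff₀ hρ]
          linarith
        linarith
      have h3 : (C * ‖ξ‖ * τ) ^ 2 ≤ (C * τ) ^ 2 * Real.exp 2 *
          (‖ξ‖ ^ 2 * Real.exp (-(2 * (1 / ρ) * m ξ))) := by
        calc (C * ‖ξ‖ * τ) ^ 2 = (C * ‖ξ‖ * τ) ^ 2 * 1 := (mul_one _).symm
          _ ≤ (C * ‖ξ‖ * τ) ^ 2 * (Real.exp 2 * Real.exp (-(2 * (1 / ρ) * m ξ))) := by gcongr
          _ = _ := by ring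
      calc _ ≤ 0 := mul_nonpos_of_nonneg_of_nonpos hρ.le (by linarith)
        _ ≤ _ := by positivity
  · rw [integral_const_mul, integral_sub iW (hJ.const_mul _), integral_const_mul]

end Energy

/-! ### Decay by Fourier splitting and dyadic iteration -/

lemma decay_of_dyadic_recursion {y : ℝ → ℝ} {B D γ T K : ℝ} (hγ : 0 < γ) (hB0 : 0 ≤ B)
    (hB : ∀ t, 0 ≤ t → y t ≤ B) (hT : 4 ≤ T) (hK : (4 : ℝ) ^ γ ≤ K)
    (hrec : ∀ t, T < t → ∃ s ∈ Set.Icc (t / 4) (t / 2),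
      (1 + K) * y t ≤ y s + D * t ^ (-γ)) {t : ℝ} (ht : T / 4 ≤ t) :
    y t ≤ max (B * T ^ γ) D * t ^ (-γ) := by
  set M := max (B * T ^ γ) D with hM
  have hT0 : 0 < T := by linarith
  have hM0 : 0 ≤ M := le_max_of_le_left (by positivity)
  -- For t > T the earlier time satisfies T/4 < s ≤ t/2, so it falls in the range of the induction
  -- hypothesis; this is why the range starts at T/4.
  have key : ∀ n : ℕ, ∀ t, T / 4 ≤ t → t ≤ T * 2 ^ n → y t ≤ M * t ^ (-γ) := by
    intro n
    induction n with
    | zero =>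
      intro t h1 h2
      have ht0 : 0 < t := by linarith
      rw [pow_zero, mul_one] at h2
      calc y t ≤ B := hB t ht0.le
        _ = B * t ^ γ * t ^ (-γ) := by
            rw [mul_assoc, ← Real.rpow_add ht0]
            simp
        _ ≤ B * T ^ γ * t ^ (-γ) := by gcongr
        _ ≤ M * t ^ (-γ) := by
            gcongr
            exact le_max_left _ _
    | succ n ih =>
      intro t h1 h2
      rcases le_or_gt t T with h | h
      · refine ih t h1 (h.trans (le_mul_of_one_le_right hT0.le ?_))
        exact one_le_pow₀ (by norm_num)
      · obtain ⟨s, hs, hrec⟩ := hrec t h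
        have ht0 : 0 < t := by linarith
        have hs0 : 0 < s := by linarith [hs.1]
        have h3 := ih s (by linarith [hs.1]) (by rw [pow_succ] at h2; linarith [hs.2])
        have h4 : s ^ (-γ) ≤ 4 ^ γ * t ^ (-γ) := by
          calc s ^ (-γ) ≤ (t / 4) ^ (-γ) :=
                Real.rpow_le_rpow_of_nonpos (by positivity) hs.1 (by linarith)
            _ = 4 ^ γ * t ^ (-γ) := by
                rw [Real.div_rpow ht0.le (by norm_num), Real.rpow_neg (by norm_num : (0:ℝ) ≤ 4)]
                field_simp
        have htγ : 0 < t ^ (-γ) := Real.rpow_pos_of_pos ht0 _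
        have hK0 : 0 < 1 + K := by
          have : (0 : ℝ) < 4 ^ γ := Real.rpow_pos_of_pos (by norm_num) _
          linarith
        refine le_of_mul_le_mul_left ?_ hK0
        -- Going from `s` to `t` costs the factor 4^γ ≤ K, and the extra 1 in 1 + K absorbs the
        -- error D ≤ M.
        calc (1 + K) * y t ≤ y s + D * t ^ (-γ) := hrec
          _ ≤ M * (4 ^ γ * t ^ (-γ)) + M * t ^ (-γ) := by
              gcongr
              · exact h3.trans (by gcongr)
              · exact le_max_right _ _
          _ ≤ M * (K * t ^ (-γ)) + M * t ^ (-γ) := by gcongr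
          _ = (1 + K) * (M * t ^ (-γ)) := by ring
  obtain ⟨n, hn⟩ := pow_unbounded_of_one_lt (t / T) (by norm_num : (1 : ℝ) < 2)
  refine key n t ht ?_
  rw [div_lt_iff₀ hT0] at hn
  linarith

section Energy

variable {m : Plane → ℝ} {N : ℝ → Plane → ℂ} {C : ℝ} {X₀ : Plane → ℂ}

/-- The integral `∫ |ξ|² e^{-2τm}` measuring the decay of the gradient of the linear flow. -/
def gradientDecay (m : Plane → ℝ) (τ : ℝ) : ℝ :=
  ∫ ξ : Plane, ‖ξ‖ ^ 2 * Real.exp (-(2 * τ * m ξ))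

lemma gradientDecay_nonneg (m : Plane → ℝ) (τ : ℝ) : 0 ≤ gradientDecay m τ :=
  integral_nonneg fun _ => by positivity

lemma gradientDecay_anti (hm0 : ∀ ξ, 0 ≤ m ξ)
    (hJ : ∀ τ : ℝ, 0 < τ → Integrable (fun ξ : Plane => ‖ξ‖ ^ 2 * Real.exp (-(2 * τ * m ξ))))
    {s t : ℝ} (hs : 0 < s) (hst : s ≤ t) : gradientDecay m t ≤ gradientDecay m s := by
  refine integral_mono (hJ t (hs.trans_le hst)) (hJ s hs) fun ξ => ?_
  have := hm0 ξ
  simp only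
  gcongr

/-- One step of the Fourier splitting method. -/
lemma fourier_splitting (hm : Continuous m) (hm0 : ∀ ξ, 0 ≤ m ξ)
    (hN : StronglyMeasurable (Function.uncurry N)) (hC : 0 ≤ C)
    (hNb : ∀ s ξ, ‖N s ξ‖ ≤ C * ‖ξ‖) (hX : MemLp X₀ 2 volume)
    (hJ : ∀ τ : ℝ, 0 < τ → Integrable (fun ξ : Plane => ‖ξ‖ ^ 2 * Real.exp (-(2 * τ * m ξ))))
    (hV : ∀ t, 0 ≤ t → MemLp (duhamel m N X₀ t) 2 volume)
    (hE : ∀ᵐ s ∂(volume.restrict (Set.Ioi (0 : ℝ))), ∀ t, s ≤ t →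
      ENNReal.ofReal (∫ ξ, ‖duhamel m N X₀ t ξ‖ ^ 2) +
      2 * ∫⁻ τ in Set.Ioc s t, ∫⁻ ξ, ENNReal.ofReal (m ξ * ‖duhamel m N X₀ τ ξ‖ ^ 2) ≤
        ENNReal.ofReal (∫ ξ, ‖duhamel m N X₀ s ξ‖ ^ 2)) :
    ∀ᵐ s ∂(volume.restrict (Set.Ioi (0 : ℝ))), ∀ t ρ : ℝ, s ≤ t → 0 < ρ →
      (1 + 2 * (t - s) * ρ) * (∫ ξ, ‖duhamelIntegral m N t ξ‖ ^ 2) ≤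
        (∫ ξ, ‖duhamelIntegral m N s ξ‖ ^ 2) +
        (1 + 2 * (t - s) * ρ) *
          (2 * (t - s) * (C * (√(gradientDecay m s) * √(∫ ξ, ‖X₀ ξ‖ ^ 2)))) +
        2 * (t - s) * ρ * ((C * t) ^ 2 * Real.exp 2 * gradientDecay m (1 / ρ)) := by
  filter_upwards [hE, ae_restrict_mem measurableSet_Ioi] with s hEs hs t ρ hst hρ
  have hs : 0 < s := hs
  have hE' : ∀ᵐ τ ∂(volume.restrict (Set.Ioc s t)), ∀ t, τ ≤ t →
      ENNReal.ofReal (∫ ξ, ‖duhamel m N X₀ t ξ‖ ^ 2) +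
      2 * ∫⁻ τ in Set.Ioc τ t, ∫⁻ ξ, ENNReal.ofReal (m ξ * ‖duhamel m N X₀ τ ξ‖ ^ 2) ≤
        ENNReal.ofReal (∫ ξ, ‖duhamel m N X₀ τ ξ‖ ^ 2) :=
    ae_restrict_of_ae_restrict_of_subset (fun τ hτ => hs.trans hτ.1) hE
  -- Comparison between τ and t, with zero dissipation, bounds ‖W(τ)‖² below by ‖W(t)‖² up to the
  -- work. The resulting lower bound of the dissipation does not depend on τ, so no differential
  -- inequality is needed.
  have hc : ∀ᵐ τ ∂(volume.restrict (Set.Ioc s t)), ∃ l : Plane → ℝ, Integrable l ∧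
      (∀ ξ, l ξ ≤ m ξ * ‖duhamelIntegral m N τ ξ‖ ^ 2) ∧
      ρ * ((∫ ξ, ‖duhamelIntegral m N t ξ‖ ^ 2) -
        2 * (t - s) * (C * (√(gradientDecay m s) * √(∫ ξ, ‖X₀ ξ‖ ^ 2))) -
        (C * t) ^ 2 * Real.exp 2 * gradientDecay m (1 / ρ)) ≤ ∫ ξ, l ξ := by
    filter_upwards [hE', ae_restrict_mem measurableSet_Ioc] with τ hτ hmem
    have hτ0 : 0 < τ := hs.trans hmem.1
    obtain ⟨l, hl, hlW, hlc⟩ := exists_lower_bound_dissipation hm0 hNb hτ0.le hρ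
      (hJ (1 / ρ) (by positivity)) (memLp_duhamelIntegral hm hm0 hX hτ0.le (hV τ hτ0.le))
    refine ⟨l, hl, hlW, le_trans ?_ hlc⟩
    have h1 := energy_comparison hm hm0 hN hC hNb hX hJ hV hτ0 hmem.2 (hτ t hmem.2) (c := 0)
      (Filter.Eventually.of_forall fun σ => ⟨fun _ => 0, integrable_zero _ _ _, fun ξ => by
        have := hm0 ξ
        positivity, by simp⟩)
    have h2 : (t - τ) * (C * (√(gradientDecay m τ) * √(∫ ξ, ‖X₀ ξ‖ ^ 2))) ≤
        (t - s) * (C * (√(gradientDecay m s) * √(∫ ξ, ‖X₀ ξ‖ ^ 2))) := by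
      have := gradientDecay_anti hm0 hJ hs hmem.1.le
      have h3 : 0 ≤ t - s := by linarith
      have := hmem.1.le
      gcongr
    have h3 : (C * τ) ^ 2 * Real.exp 2 * gradientDecay m (1 / ρ) ≤
        (C * t) ^ 2 * Real.exp 2 * gradientDecay m (1 / ρ) := by
      have := gradientDecay_nonneg m (1 / ρ)
      have := hmem.2
      gcongr
    change _ ≤ ρ * (_ - (C * τ) ^ 2 * Real.exp 2 * gradientDecay m (1 / ρ))
    change _ ≤ _ + 2 * ((t - τ) * (C * (√(gradientDecay m τ) * _))) at h1
    refine mul_le_mul_of_nonneg_left ?_ hρ.le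
    linarith
  have h := energy_comparison hm hm0 hN hC hNb hX hJ hV hs hst (hEs t hst) hc
  change _ ≤ _ + 2 * ((t - s) * (C * (√(gradientDecay m s) * _))) at h
  linarith

/-- Decay of `W`, given polynomial decay of the gradient of the linear flow. -/
lemma exists_decay_duhamelIntegral (hm : Continuous m) (hm0 : ∀ ξ, 0 ≤ m ξ) (hC : 0 ≤ C)
    (hX : MemLp X₀ 2 volume) {γ c : ℝ} (hγ : 0 < γ) (hc : 0 ≤ c)
    (hJ : ∀ τ : ℝ, 0 < τ → Integrable (fun ξ : Plane => ‖ξ‖ ^ 2 * Real.exp (-(2 * τ * m ξ))))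
    (hJc : ∀ τ : ℝ, 1 ≤ τ → gradientDecay m τ ≤ c * τ ^ (-(2 * γ + 2))) :
    ∃ M : ℝ, 0 < M ∧ ∀ N : ℝ → Plane → ℂ, StronglyMeasurable (Function.uncurry N) →
      (∀ s ξ, ‖N s ξ‖ ≤ C * ‖ξ‖) → (∀ t, 0 ≤ t → MemLp (duhamel m N X₀ t) 2 volume) →
      (∀ t, 0 ≤ t → ∫ ξ, ‖duhamel m N X₀ t ξ‖ ^ 2 ≤ ∫ ξ, ‖X₀ ξ‖ ^ 2) →
      (∀ᵐ s ∂(volume.restrict (Set.Ioi (0 : ℝ))), ∀ t, s ≤ t →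
        ENNReal.ofReal (∫ ξ, ‖duhamel m N X₀ t ξ‖ ^ 2) +
        2 * ∫⁻ τ in Set.Ioc s t, ∫⁻ ξ, ENNReal.ofReal (m ξ * ‖duhamel m N X₀ τ ξ‖ ^ 2) ≤
          ENNReal.ofReal (∫ ξ, ‖duhamel m N X₀ s ξ‖ ^ 2)) →
      ∀ t, 0 ≤ t → ∫ ξ, ‖duhamelIntegral m N t ξ‖ ^ 2 ≤ M * (1 + t) ^ (-γ) := by
  set A := ∫ ξ, ‖X₀ ξ‖ ^ 2 with hA
  have hA0 : 0 ≤ A := integral_nonneg fun ξ => sq_nonneg _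
  -- K is the gain required by `decay_of_dyadic_recursion`. For t > T = 4K both t/K and s ≥ t/4 are
  -- at least 1, where the bound `hJc` applies.
  set K : ℝ := 4 ^ γ with hK
  have hK1 : 1 ≤ K := Real.one_le_rpow (by norm_num) hγ.le
  set T : ℝ := 4 * K with hT
  set D : ℝ := (1 + 2 * K) * (2 * (C * (√c * 4 ^ (γ + 1) * √A))) +
    2 * K * (C ^ 2 * Real.exp 2 * (c * K ^ (2 * γ + 2))) with hD
  set M₀ : ℝ := max (4 * A * T ^ γ) D with hM₀
  have hM₀0 : 0 ≤ M₀ := le_max_of_le_left (by positivity)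
  -- The first term serves t > T, the second t ≤ T, and the 1 keeps the constant positive when the
  -- data vanish.
  refine ⟨M₀ * 2 ^ γ + 4 * A * (1 + T) ^ γ + 1, by positivity,
    fun N hN hNb hV hVA hE => ?_⟩
  have hy : ∀ t, 0 ≤ ∫ ξ, ‖duhamelIntegral m N t ξ‖ ^ 2 := fun t =>
    integral_nonneg fun ξ => sq_nonneg _
  have hB : ∀ t, 0 ≤ t → ∫ ξ, ‖duhamelIntegral m N t ξ‖ ^ 2 ≤ 4 * A := by
    intro t ht
    have i1 := (hV t ht).norm.integrable_sq
    have i2 := hX.norm.integrable_sq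
    calc ∫ ξ, ‖duhamelIntegral m N t ξ‖ ^ 2
        ≤ ∫ ξ, (2 * ‖duhamel m N X₀ t ξ‖ ^ 2 + 2 * ‖X₀ ξ‖ ^ 2) := by
          refine integral_mono (memLp_duhamelIntegral hm hm0 hX ht (hV t ht)).norm.integrable_sq
            ((i1.const_mul 2).add (i2.const_mul 2)) fun ξ => ?_
          have h1 : duhamelIntegral m N t ξ = duhamel m N X₀ t ξ - linearFlow m X₀ t ξ := by
            simp [duhamel, linearFlow]
          have h2 : ‖linearFlow m X₀ t ξ‖ ≤ ‖X₀ ξ‖ := by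
            simpa using norm_linearFlow_le (X₀ := X₀) hm0 ht ξ
          have h3 : ‖duhamelIntegral m N t ξ‖ ≤ ‖duhamel m N X₀ t ξ‖ + ‖X₀ ξ‖ := by
            rw [h1]
            exact (norm_sub_le _ _).trans (add_le_add le_rfl h2)
          calc ‖duhamelIntegral m N t ξ‖ ^ 2 ≤ (‖duhamel m N X₀ t ξ‖ + ‖X₀ ξ‖) ^ 2 := by gcongr
            _ ≤ _ := by nlinarith [sq_nonneg (‖duhamel m N X₀ t ξ‖ - ‖X₀ ξ‖)]
      _ = 2 * (∫ ξ, ‖duhamel m N X₀ t ξ‖ ^ 2) + 2 * A := by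
          rw [integral_add (i1.const_mul 2) (i2.const_mul 2), integral_const_mul,
            integral_const_mul]
      _ ≤ 4 * A := by linarith [hVA t ht]
  have hsplit := fourier_splitting hm hm0 hN hC hNb hX hJ hV hE
  have hrec : ∀ t, T < t → ∃ s ∈ Set.Icc (t / 4) (t / 2),
      (1 + K) * (∫ ξ, ‖duhamelIntegral m N t ξ‖ ^ 2) ≤
        (∫ ξ, ‖duhamelIntegral m N s ξ‖ ^ 2) + D * t ^ (-γ) := by
    intro t ht
    have ht4 : 4 < t := by linarith
    have ht0 : 0 < t := by linarith
    -- The splitting estimate holds only for almost every starting time, so `s` is picked from an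
    -- interval of positive measure.
    have hae : ∀ᵐ s ∂(volume.restrict (Set.Icc (t / 4) (t / 2))), _ :=
      ae_restrict_of_ae_restrict_of_subset (fun s hs => by
        have : t / 4 ≤ s := hs.1
        exact lt_of_lt_of_le (by positivity) this) hsplit
    have hne : (volume.restrict (Set.Icc (t / 4) (t / 2))) ≠ 0 := by
      rw [Ne, Measure.restrict_eq_zero, Real.volume_Icc, ENNReal.ofReal_eq_zero, not_le]
      linarith
    have : (ae (volume.restrict (Set.Icc (t / 4) (t / 2)))).NeBot := ae_neBot.mpr hne
    obtain ⟨s, hs, hmem⟩ := (hae.and (ae_restrict_mem measurableSet_Icc)).exists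
    refine ⟨s, hmem, ?_⟩
    have hs1 : 1 ≤ s := by linarith [hmem.1]
    have hs0 : 0 < s := by linarith
    -- With ρ = K/t and s in [t/4, t/2], the coefficient 2(t-s)ρ lies between K and 2K.
    have h := hs t (K / t) (by linarith [hmem.2]) (by positivity)
    have ha1 : K ≤ 2 * (t - s) * (K / t) := by
      rw [mul_div_assoc', le_div_iff₀ ht0]
      nlinarith [hmem.2]
    have ha2 : 2 * (t - s) * (K / t) ≤ 2 * K := by
      rw [mul_div_assoc', div_le_iff₀ ht0]
      nlinarith [hmem.1]
    -- The work error is of order t · t^{-(γ+1)} = t^{-γ}; it is the one that dictates the rate.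
    have hb : 2 * (t - s) * (C * (√(gradientDecay m s) * √A)) ≤
        2 * (C * (√c * 4 ^ (γ + 1) * √A)) * t ^ (-γ) := by
      have h1 : √(gradientDecay m s) ≤ √c * 4 ^ (γ + 1) * t ^ (-(γ + 1)) := by
        have h2 : s ^ (-(2 * γ + 2)) ≤ (4 ^ (γ + 1) * t ^ (-(γ + 1))) ^ 2 := by
          calc s ^ (-(2 * γ + 2)) ≤ (t / 4) ^ (-(2 * γ + 2)) :=
                Real.rpow_le_rpow_of_nonpos (by positivity) hmem.1 (by linarith)
            _ = ((t / 4) ^ (-(γ + 1))) ^ 2 := by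
                rw [← Real.rpow_mul_natCast (by positivity)]
                congr 1
                push_cast
                ring
            _ = _ := by
                rw [Real.div_rpow ht0.le (by norm_num), Real.rpow_neg (by norm_num : (0:ℝ) ≤ 4)]
                field_simp
        calc √(gradientDecay m s) ≤ √(c * (4 ^ (γ + 1) * t ^ (-(γ + 1))) ^ 2) := by
              refine Real.sqrt_le_sqrt ((hJc s hs1).trans ?_)
              gcongr
          _ = _ := by
              rw [Real.sqrt_mul hc, Real.sqrt_sq (by positivity), mul_assoc]
      have h3 : t * t ^ (-(γ + 1)) = t ^ (-γ) := by
        rw [← Real.rpow_one_add' ht0.le (by linarith)]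
        congr 1
        ring
      calc 2 * (t - s) * (C * (√(gradientDecay m s) * √A))
          ≤ 2 * t * (C * ((√c * 4 ^ (γ + 1) * t ^ (-(γ + 1))) * √A)) := by
            have : t - s ≤ t := by linarith
            gcongr
        _ = 2 * (C * (√c * 4 ^ (γ + 1) * √A)) * (t * t ^ (-(γ + 1))) := by ring
        _ = _ := by rw [h3]
    -- The low-frequency error is of order t² · t^{-(2γ+2)} = t^{-2γ}, better than needed.
    have hl : (C * t) ^ 2 * Real.exp 2 * gradientDecay m (1 / (K / t)) ≤
        C ^ 2 * Real.exp 2 * (c * K ^ (2 * γ + 2)) * t ^ (-γ) := by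
      have h1 : gradientDecay m (1 / (K / t)) ≤ c * K ^ (2 * γ + 2) * t ^ (-(2 * γ + 2)) := by
        rw [one_div_div]
        refine (hJc (t / K) ?_).trans (le_of_eq ?_)
        · rw [le_div_iff₀ (by positivity)]
          linarith
        · rw [Real.div_rpow ht0.le (by positivity), Real.rpow_neg (by positivity : (0:ℝ) ≤ K)]
          field_simp
      have h2 : t ^ 2 * t ^ (-(2 * γ + 2)) ≤ t ^ (-γ) := by
        rw [← Real.rpow_natCast, ← Real.rpow_add ht0]
        refine Real.rpow_le_rpow_of_exponent_le (by linarith) ?_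
        push_cast
        linarith
      calc (C * t) ^ 2 * Real.exp 2 * gradientDecay m (1 / (K / t))
          ≤ (C * t) ^ 2 * Real.exp 2 * (c * K ^ (2 * γ + 2) * t ^ (-(2 * γ + 2))) := by gcongr
        _ = C ^ 2 * Real.exp 2 * (c * K ^ (2 * γ + 2)) * (t ^ 2 * t ^ (-(2 * γ + 2))) := by ring
        _ ≤ _ := by gcongr
    have hyt := hy t
    calc (1 + K) * (∫ ξ, ‖duhamelIntegral m N t ξ‖ ^ 2)
        ≤ (1 + 2 * (t - s) * (K / t)) * (∫ ξ, ‖duhamelIntegral m N t ξ‖ ^ 2) := by gcongr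
      _ ≤ _ := h
      _ ≤ (∫ ξ, ‖duhamelIntegral m N s ξ‖ ^ 2) +
          (1 + 2 * K) * (2 * (C * (√c * 4 ^ (γ + 1) * √A)) * t ^ (-γ)) +
          2 * K * (C ^ 2 * Real.exp 2 * (c * K ^ (2 * γ + 2)) * t ^ (-γ)) := by
          have h1 : 0 ≤ 2 * (t - s) * (K / t) := by linarith
          have h2 := gradientDecay_nonneg m (1 / (K / t))
          have h3 : 0 ≤ t - s := by linarith [hmem.2]
          gcongr
      _ = _ := by rw [hD]; ring
  intro t ht
  rcases le_or_gt t T with h | h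
  · have h1 : (1 : ℝ) ≤ (1 + T) ^ γ * (1 + t) ^ (-γ) := by
      rw [Real.rpow_neg (by positivity), ← div_eq_mul_inv, one_le_div (by positivity)]
      gcongr
    calc ∫ ξ, ‖duhamelIntegral m N t ξ‖ ^ 2 ≤ 4 * A * 1 := by
          rw [mul_one]
          exact hB t ht
      _ ≤ 4 * A * ((1 + T) ^ γ * (1 + t) ^ (-γ)) := by gcongr
      _ = (4 * A * (1 + T) ^ γ) * (1 + t) ^ (-γ) := by ring
      _ ≤ _ := by
          gcongr
          have : 0 ≤ M₀ * 2 ^ γ := by positivity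
          linarith
  · have h0 := decay_of_dyadic_recursion (B := 4 * A) hγ (by positivity) hB
      (by linarith : 4 ≤ T) le_rfl hrec (t := t) (by linarith)
    have ht1 : 1 ≤ t := by linarith
    have ht0 : 0 < t := by linarith
    have h1 : t ^ (-γ) ≤ 2 ^ γ * (1 + t) ^ (-γ) := by
      calc t ^ (-γ) ≤ ((1 + t) / 2) ^ (-γ) :=
            Real.rpow_le_rpow_of_nonpos (by positivity) (by linarith) (by linarith)
        _ = 2 ^ γ * (1 + t) ^ (-γ) := by
            rw [Real.div_rpow (by positivity) (by norm_num),
              Real.rpow_neg (by norm_num : (0:ℝ) ≤ 2)]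
            field_simp
    calc ∫ ξ, ‖duhamelIntegral m N t ξ‖ ^ 2 ≤ M₀ * t ^ (-γ) := h0
      _ ≤ M₀ * (2 ^ γ * (1 + t) ^ (-γ)) := by gcongr
      _ = (M₀ * 2 ^ γ) * (1 + t) ^ (-γ) := by ring
      _ ≤ _ := by
          gcongr
          have : 0 ≤ 4 * A * (1 + T) ^ γ := by positivity
          linarith

end Energy

/-! ### The Fourier side of real-valued functions -/

lemma continuous_toComplex : Continuous toComplex :=
  (Complex.ofRealCLM.compLpL 2 (volume : Measure Plane)).continuous

lemma toComplex_sub (f g : RealL2) : toComplex (f - g) = toComplex f - toComplex g :=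
  (Complex.ofRealCLM.compLpL 2 (volume : Measure Plane)).map_sub f g

lemma coeFn_toComplex (f : RealL2) : toComplex f =ᵐ[volume] fun x => (f x : ℂ) :=
  Complex.ofRealCLM.coeFn_compLp f

lemma norm_toComplex (f : RealL2) : ‖toComplex f‖ = ‖f‖ := by
  refine le_antisymm (Lp.norm_le_norm_of_ae_le ?_) (Lp.norm_le_norm_of_ae_le ?_) <;>
  · filter_upwards [coeFn_toComplex f] with x hx
    rw [hx, Complex.norm_real]

/-- The complex conjugate of the Fourier transform of a real-valued function. -/
def spectrum (f : RealL2) : ComplexL2 :=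
  (Complex.conjCLE : ℂ →L[ℝ] ℂ).compLp (𝓕 (toComplex f))

lemma coeFn_spectrum (f : RealL2) :
    spectrum f =ᵐ[volume] fun ξ => star (𝓕 (toComplex f) ξ) := by
  filter_upwards [(Complex.conjCLE : ℂ →L[ℝ] ℂ).coeFn_compLp (𝓕 (toComplex f))] with ξ hξ
  exact hξ

lemma continuous_fourier_L2 : Continuous fun f : ComplexL2 => (𝓕 f : ComplexL2) :=
  (Lp.fourierTransformₗᵢ Plane ℂ).continuous

lemma fourier_sub_L2 (f g : ComplexL2) : (𝓕 (f - g) : ComplexL2) = 𝓕 f - 𝓕 g :=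
  (Lp.fourierTransformₗᵢ Plane ℂ).map_sub f g

lemma norm_fourierInv_L2 (f : ComplexL2) : ‖(𝓕⁻ f : ComplexL2)‖ = ‖f‖ :=
  (Lp.fourierTransformₗᵢ Plane ℂ).symm.norm_map f

lemma fourierInv_sub_L2 (f g : ComplexL2) : (𝓕⁻ (f - g) : ComplexL2) = 𝓕⁻ f - 𝓕⁻ g :=
  (Lp.fourierTransformₗᵢ Plane ℂ).symm.map_sub f g

lemma continuous_spectrum : Continuous spectrum :=
  ((Complex.conjCLE : ℂ →L[ℝ] ℂ).compLpL 2 (volume : Measure Plane)).continuous.comp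
    (continuous_fourier_L2.comp continuous_toComplex)

lemma spectrum_sub (f g : RealL2) : spectrum (f - g) = spectrum f - spectrum g := by
  rw [spectrum, toComplex_sub, fourier_sub_L2]
  exact ((Complex.conjCLE : ℂ →L[ℝ] ℂ).compLpL 2 (volume : Measure Plane)).map_sub _ _

lemma norm_spectrum (f : RealL2) : ‖spectrum f‖ = ‖f‖ := by
  rw [← norm_toComplex f, ← Lp.norm_fourier_eq (toComplex f)]
  refine le_antisymm (Lp.norm_le_norm_of_ae_le ?_) (Lp.norm_le_norm_of_ae_le ?_) <;>
  · filter_upwards [coeFn_spectrum f] with x hx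
    rw [hx, norm_star]

lemma norm_sq_eq_integral (F : ComplexL2) : ‖F‖ ^ 2 = ∫ ξ, ‖F ξ‖ ^ 2 := by
  have h := L2.inner_def (𝕜 := ℂ) F F
  simp only [inner_self_eq_norm_sq_to_K] at h
  have h2 : ((‖F‖ ^ 2 : ℝ) : ℂ) = ((∫ ξ, ‖F ξ‖ ^ 2 : ℝ) : ℂ) := by
    rw [← integral_complex_ofReal]
    push_cast
    exact h
  exact_mod_cast h2

/-- Plancherel's theorem for the pairing with a real-valued function. -/
lemma integral_ofReal_mul_eq (f : RealL2) (F : ComplexL2) :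
    ∫ x, (f x : ℂ) * F x = ∫ ξ, spectrum f ξ * (𝓕 F : ComplexL2) ξ := by
  have h1 : ∫ x, (f x : ℂ) * F x = inner ℂ (toComplex f) F := by
    rw [L2.inner_def]
    refine integral_congr_ae ?_
    filter_upwards [coeFn_toComplex f] with x hx
    rw [hx, RCLike.inner_apply, Complex.conj_ofReal, mul_comm]
  have h2 : ∫ ξ, spectrum f ξ * (𝓕 F : ComplexL2) ξ =
      inner ℂ (𝓕 (toComplex f) : ComplexL2) (𝓕 F : ComplexL2) := by
    rw [L2.inner_def]
    refine integral_congr_ae ?_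
    filter_upwards [coeFn_spectrum f] with ξ hξ
    rw [hξ, RCLike.inner_apply, mul_comm, Complex.star_def]
  rw [h1, h2]
  exact (Lp.inner_fourier_eq (toComplex f) F).symm

/-- Testing with 𝓕⁻χ moves the weak equation to the frequency side. Conjugation in `spectrum` makes
the pairing bilinear, with no reflection of ξ. -/
lemma integral_ofReal_mul_schwartz (f : RealL2) (χ : 𝓢(Plane, ℂ)) :
    ∫ x, (f x : ℂ) * (𝓕⁻ χ : 𝓢(Plane, ℂ)) x = ∫ ξ, spectrum f ξ * χ ξ := by
  have h := integral_ofReal_mul_eq f ((𝓕⁻ χ : 𝓢(Plane, ℂ)).toLp 2)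
  rw [SchwartzMap.toLp_fourier_eq, FourierTransform.fourier_fourierInv_eq] at h
  have h1 : ∫ x, (f x : ℂ) * (𝓕⁻ χ : 𝓢(Plane, ℂ)) x =
      ∫ x, (f x : ℂ) * ((𝓕⁻ χ : 𝓢(Plane, ℂ)).toLp 2 : ComplexL2) x := by
    refine integral_congr_ae ?_
    filter_upwards [(𝓕⁻ χ : 𝓢(Plane, ℂ)).coeFn_toLp 2 volume] with x hx
    rw [hx]
  rw [h1, h]
  refine integral_congr_ae ?_
  filter_upwards [χ.coeFn_toLp 2 volume] with x hx
  rw [hx]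

lemma dissipationPairing_eq {α β : ℝ} (hα : 0 < α) (hβ : 0 < β) (f : RealL2)
    (χ : 𝓢(Plane, ℂ)) : dissipationPairing α β f (𝓕⁻ χ) =
      ∫ ξ, spectrum f ξ * (dissipationSymbol α β ξ * χ ξ) := by
  have h0 := memLp_absDeriv_schwartz 0 (s := 2 * α) (by positivity) (𝓕⁻ χ)
  have h1 := memLp_absDeriv_schwartz 1 (s := 2 * β) (by positivity) (𝓕⁻ χ)
  have e : dissipationPairing α β f (𝓕⁻ χ) =
      ∫ x, (f x : ℂ) * (𝓕⁻ (h0.toLp _ + h1.toLp _) : ComplexL2) x := by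
    rw [dissipationPairing]
    refine integral_congr_ae ?_
    have h2 : (𝓕⁻ (h0.toLp _ + h1.toLp _) : ComplexL2) =
        absDeriv 0 (2 * α) ((𝓕⁻ χ : 𝓢(Plane, ℂ)).toLp 2) +
        absDeriv 1 (2 * β) ((𝓕⁻ χ : 𝓢(Plane, ℂ)).toLp 2) := by
      rw [absDeriv, absDeriv, fourierMultiplier, fourierMultiplier, dif_pos h0, dif_pos h1]
      exact (Lp.fourierTransformₗᵢ Plane ℂ).symm.map_add _ _
    rw [h2]
    filter_upwards [Lp.coeFn_add (absDeriv 0 (2 * α) ((𝓕⁻ χ : 𝓢(Plane, ℂ)).toLp 2))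
      (absDeriv 1 (2 * β) ((𝓕⁻ χ : 𝓢(Plane, ℂ)).toLp 2))] with x hx
    rw [hx, Pi.add_apply]
  rw [e, integral_ofReal_mul_eq, FourierTransform.fourier_fourierInv_eq]
  refine integral_congr_ae ?_
  have h3 : (𝓕 ((𝓕⁻ χ : 𝓢(Plane, ℂ)).toLp 2 : ComplexL2) : ComplexL2) = χ.toLp 2 := by
    rw [SchwartzMap.toLp_fourier_eq, FourierTransform.fourier_fourierInv_eq]
  filter_upwards [Lp.coeFn_add (h0.toLp _) (h1.toLp _), h0.coeFn_toLp, h1.coeFn_toLp,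
    χ.coeFn_toLp 2 volume] with ξ e1 e2 e3 e4
  rw [e1, Pi.add_apply, e2, e3, h3, e4, dissipationSymbol]
  push_cast
  ring

/-! ### The transport term -/

lemma norm_rieszSymbol_le (j : Fin 2) (ξ : Plane) : ‖rieszSymbol j ξ‖ ≤ 1 := by
  have h1 : |ξ j| ≤ ‖ξ‖ := by simpa using PiLp.norm_apply_le ξ j
  simp only [rieszSymbol, norm_mul, Complex.norm_I, one_mul, Complex.norm_real,
    Real.norm_eq_abs, abs_div, abs_norm]
  exact div_le_one_of_le₀ h1 (norm_nonneg _)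

lemma norm_riesz_sub_le (j : Fin 2) (f g : ComplexL2) : ‖riesz j f - riesz j g‖ ≤ ‖f - g‖ := by
  rw [riesz, riesz, fourierMultiplier, fourierMultiplier, dif_pos (memLp_riesz j f),
    dif_pos (memLp_riesz j g), ← fourierInv_sub_L2, norm_fourierInv_L2,
    ← Lp.norm_fourier_eq (f - g), fourier_sub_L2]
  refine Lp.norm_le_norm_of_ae_le ?_
  filter_upwards [Lp.coeFn_sub ((memLp_riesz j f).toLp _) ((memLp_riesz j g).toLp _),
    (memLp_riesz j f).coeFn_toLp, (memLp_riesz j g).coeFn_toLp,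
    Lp.coeFn_sub (𝓕 f : ComplexL2) (𝓕 g)] with ξ h1 h2 h3 h4
  rw [h1, h4, Pi.sub_apply, Pi.sub_apply, h2, h3, ← mul_sub, norm_mul]
  exact mul_le_of_le_one_left (norm_nonneg _) (norm_rieszSymbol_le j ξ)

lemma norm_riesz_le (j : Fin 2) (f : ComplexL2) : ‖riesz j f‖ ≤ ‖f‖ := by
  rw [riesz, fourierMultiplier, dif_pos (memLp_riesz j f), norm_fourierInv_L2,
    ← Lp.norm_fourier_eq f]
  refine Lp.norm_le_norm_of_ae_le ?_
  filter_upwards [(memLp_riesz j f).coeFn_toLp] with ξ h1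
  rw [h1, norm_mul]
  exact mul_le_of_le_one_left (norm_nonneg _) (norm_rieszSymbol_le j ξ)

lemma continuous_riesz (j : Fin 2) : Continuous (riesz j) :=
  (LipschitzWith.of_dist_le_mul (K := 1) fun f g => by
    simpa [dist_eq_norm] using norm_riesz_sub_le j f g).continuous

lemma continuous_velocity (j : Fin 2) : Continuous fun f : RealL2 => velocity f j := by
  fin_cases j
  · exact ((continuous_riesz 1).comp continuous_toComplex).neg
  · exact (continuous_riesz 0).comp continuous_toComplex

lemma norm_velocity_le (j : Fin 2) (f : RealL2) : ‖velocity f j‖ ≤ ‖f‖ := by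
  rw [← norm_toComplex f]
  fin_cases j
  · exact (norm_neg _).trans_le (norm_riesz_le 1 _)
  · exact norm_riesz_le 0 _

/-- The flux `f u` with `u = R^⊥ f`, as an integrable function. -/
def flux (j : Fin 2) (f : RealL2) : Lp ℂ 1 (volume : Measure Plane) :=
  (ContinuousLinearMap.mul ℂ ℂ).holder 1 (toComplex f) (velocity f j)

lemma coeFn_flux (j : Fin 2) (f : RealL2) :
    flux j f =ᵐ[volume] fun x => (f x : ℂ) * velocity f j x := by
  filter_upwards [(ContinuousLinearMap.mul ℂ ℂ).coeFn_holder (r := 1) (toComplex f) (velocity f j),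
    coeFn_toComplex f] with x h1 h2
  rw [flux, h1, h2]
  rfl

lemma norm_flux_le (j : Fin 2) (f : RealL2) : ‖flux j f‖ ≤ ‖f‖ ^ 2 := by
  calc ‖flux j f‖ ≤ ‖ContinuousLinearMap.mul ℂ ℂ‖ * ‖toComplex f‖ * ‖velocity f j‖ :=
        (ContinuousLinearMap.mul ℂ ℂ).norm_holder_apply_apply_le _ _
    _ ≤ 1 * ‖f‖ * ‖f‖ := by
        gcongr
        · exact ContinuousLinearMap.opNorm_mul_le ℂ ℂ
        · exact (norm_toComplex f).le
        · exact norm_velocity_le j f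
    _ = ‖f‖ ^ 2 := by ring

lemma continuous_flux (j : Fin 2) : Continuous (flux j) :=
  ((ContinuousLinearMap.mul ℂ ℂ).holderL (volume : Measure Plane) 2 2 1).continuous₂.comp
    (continuous_toComplex.prodMk (continuous_velocity j))

/-- The Fourier side of the transport term. -/
def transportSymbol (f : RealL2) (ξ : Plane) : ℂ :=
  ∑ j : Fin 2, (2 * Real.pi * Complex.I * (ξ j : ℂ)) * Real.Lp.fourierTransformInv (flux j f) ξ

/-- Joint continuity makes the forcing jointly measurable in time and frequency once a strongly
measurable path is inserted. -/
lemma continuous_transportSymbol :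
    Continuous fun p : RealL2 × Plane => transportSymbol p.1 p.2 := by
  refine continuous_finsetSum _ fun j _ => Continuous.mul (by fun_prop) ?_
  have h : Continuous fun f : RealL2 => Real.Lp.fourierTransformInv (flux j f) := by
    simpa [Function.comp_def] using (Real.Lp.fourierTransformInvCLM Plane ℂ).continuous.comp (continuous_flux j)
  exact (continuous_eval : Continuous fun p : (BoundedContinuousFunction Plane ℂ) × Plane =>
    p.1 p.2).comp ((h.comp continuous_fst).prodMk continuous_snd)

/-- The inverse transform of the flux is bounded by its `L¹` norm, hence by ‖f‖², as Riesz
transforms are contractions of `L²`. Each derivative gives 2π|ξⱼ|, and the two components add up to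
4π. -/
lemma norm_transportSymbol_le (f : RealL2) (ξ : Plane) :
    ‖transportSymbol f ξ‖ ≤ 4 * Real.pi * ‖f‖ ^ 2 * ‖ξ‖ := by
  have h : ∀ j : Fin 2, ‖(2 * Real.pi * Complex.I * (ξ j : ℂ)) *
      Real.Lp.fourierTransformInv (flux j f) ξ‖ ≤ 2 * Real.pi * ‖f‖ ^ 2 * ‖ξ‖ := by
    intro j
    have h1 : |ξ j| ≤ ‖ξ‖ := by simpa using PiLp.norm_apply_le ξ j
    have h2 : ‖Real.Lp.fourierTransformInv (flux j f) ξ‖ ≤ ‖f‖ ^ 2 := by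
      refine le_trans ?_ (norm_flux_le j f)
      rw [Real.Lp.fourierTransformInv_apply, Real.fourierInv_eq]
      refine (norm_integral_le_integral_norm _).trans ?_
      simp_rw [Circle.norm_smul]
      exact (L1.norm_eq_integral_norm _).symm.le
    simp only [norm_mul, Complex.norm_ofNat, Complex.norm_real, Complex.norm_I, mul_one,
      Real.norm_eq_abs, abs_of_pos Real.pi_pos]
    calc 2 * Real.pi * |ξ j| * ‖Real.Lp.fourierTransformInv (flux j f) ξ‖
        ≤ 2 * Real.pi * ‖ξ‖ * ‖f‖ ^ 2 := by gcongr
      _ = _ := by ring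
  refine (norm_sum_le _ _).trans ?_
  rw [Fin.sum_univ_two]
  linarith [h 0, h 1]

lemma integral_mul_fourierInv (G : Lp ℂ 1 (volume : Measure Plane)) (ψ : 𝓢(Plane, ℂ)) :
    ∫ x, G x * (𝓕⁻ ψ : 𝓢(Plane, ℂ)) x =
      ∫ ξ, Real.Lp.fourierTransformInv G ξ * ψ ξ := by
  have hc : Continuous fun p : Plane × Plane => (-innerₗ Plane) p.1 p.2 := by
    simp only [LinearMap.neg_apply, innerₗ_apply_apply]
    fun_prop
  have h := VectorFourier.integral_fourierIntegral_smul_eq_flip (μ := (volume : Measure Plane))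
    (ν := (volume : Measure Plane)) (L := -innerₗ Plane) Real.continuous_fourierChar hc
    (L1.integrable_coeFn G) ψ.integrable
  simp only [smul_eq_mul] at h
  have hflip : (-innerₗ Plane).flip = -innerₗ Plane := by
    ext x y
    simp [real_inner_comm]
  rw [hflip] at h
  simp only [Real.Lp.fourierTransformInv_apply, fourierInv_coe]
  exact h.symm

/-- The derivative acts on the test function as ∂ⱼ𝓕⁻χ = 𝓕⁻(2πiξⱼχ); then 𝓕⁻ is transferred to the
integrable flux. -/
lemma transportPairing_eq (f : RealL2) (χ : 𝓢(Plane, ℂ)) :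
    transportPairing f (𝓕⁻ χ) = ∫ ξ, transportSymbol f ξ * χ ξ := by
  let ψ : Fin 2 → 𝓢(Plane, ℂ) := fun j => (2 * Real.pi * Complex.I) •
    smulLeftCLM ℂ (inner ℝ · (EuclideanSpace.single j (1 : ℝ) : Plane)) χ
  have hψ : ∀ j ξ, ψ j ξ = 2 * Real.pi * Complex.I * (ξ j : ℂ) * χ ξ := fun j ξ => by
    have : (inner ℝ · (EuclideanSpace.single j (1 : ℝ) : Plane)).HasTemperateGrowth :=
      ((innerSL ℝ).flip _).hasTemperateGrowth
    simp only [ψ, smul_apply, smulLeftCLM_apply_apply this, smul_eq_mul]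
    simp [EuclideanSpace.inner_single_right, mul_assoc]
  have hd : ∀ j x, fderiv ℝ (𝓕⁻ χ : 𝓢(Plane, ℂ)) x (EuclideanSpace.single j 1) =
      (𝓕⁻ (ψ j) : 𝓢(Plane, ℂ)) x := fun j x => by
    rw [← SchwartzMap.lineDerivOp_apply_eq_fderiv, SchwartzMap.lineDerivOp_fourierInv_eq]
  have hint : ∀ j, Integrable (fun x => flux j f x * (𝓕⁻ (ψ j) : 𝓢(Plane, ℂ)) x) := fun j => by
    obtain ⟨K, hK⟩ := (𝓕⁻ (ψ j) : 𝓢(Plane, ℂ)).decay 0 0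
    exact (L1.integrable_coeFn _).mul_bdd (c := K)
      (𝓕⁻ (ψ j) : 𝓢(Plane, ℂ)).continuous.aestronglyMeasurable
      (Filter.Eventually.of_forall fun x => by simpa using hK.2 x)
  have hint2 : ∀ j, Integrable (fun ξ => Real.Lp.fourierTransformInv (flux j f) ξ * ψ j ξ) :=
    fun j => (ψ j).integrable.bdd_mul (c := ‖Real.Lp.fourierTransformInv (flux j f)‖)
      (Real.Lp.fourierTransformInv (flux j f)).continuous.aestronglyMeasurable
      (Filter.Eventually.of_forall fun ξ =>
        (Real.Lp.fourierTransformInv (flux j f)).norm_coe_le_norm ξ)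
  have e1 : transportPairing f (𝓕⁻ χ) =
      ∫ x, ∑ j : Fin 2, flux j f x * (𝓕⁻ (ψ j) : 𝓢(Plane, ℂ)) x := by
    rw [transportPairing]
    refine integral_congr_ae ?_
    filter_upwards [coeFn_flux 0 f, coeFn_flux 1 f] with x h0 h1
    simp only [Fin.sum_univ_two, hd, h0, h1]
    ring
  rw [e1, integral_finsetSum _ fun j _ => hint j]
  simp only [integral_mul_fourierInv]
  rw [← integral_finsetSum _ fun j _ => hint2 j]
  refine integral_congr_ae (Filter.Eventually.of_forall fun ξ => ?_)
  simp only [transportSymbol, Finset.sum_mul, hψ]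
  refine Finset.sum_congr rfl fun j _ => ?_
  ring

/-! ### Weak solutions on the Fourier side -/

section Transfer

variable {α β : ℝ} {θ₀ : RealL2} {θ : ℝ → RealL2}

lemma IsWeakSolution.norm_le (hθ : IsWeakSolution α β θ₀ θ) {t : ℝ} (ht : 0 ≤ t) :
    ‖θ t‖ ≤ ‖θ₀‖ := by
  have h : ‖θ t‖ₑ ^ 2 ≤ ‖θ₀‖ₑ ^ 2 := (self_le_add_right _ _).trans (hθ.energy_zero t ht)
  have h2 : ‖θ t‖ₑ ≤ ‖θ₀‖ₑ := (ENNReal.pow_le_pow_left_iff two_ne_zero).mp h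
  rwa [← ofReal_norm, ← ofReal_norm, ENNReal.ofReal_le_ofReal_iff (norm_nonneg _)] at h2

/-- The forcing has to be jointly measurable and bounded at every time, while θ is measurable only
up to a null set. Setting a measurable representative to 0 where it violates the bound changes it on
a null set of positive times, which the time integrals do not see. -/
lemma IsWeakSolution.exists_modification (hθ : IsWeakSolution α β θ₀ θ) :
    ∃ Θ : ℝ → RealL2, StronglyMeasurable Θ ∧ (∀ s, ‖Θ s‖ ≤ ‖θ₀‖) ∧
      θ =ᵐ[volume.restrict (Set.Ioi (0 : ℝ))] Θ := by
  have hm := hθ.measurable.stronglyMeasurable_mk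
  refine ⟨{s | ‖hθ.measurable.mk θ s‖ ≤ ‖θ₀‖}.indicator (hθ.measurable.mk θ),
    hm.indicator (measurableSet_le hm.norm.measurable measurable_const), fun s => ?_, ?_⟩
  · by_cases hs : s ∈ {s | ‖hθ.measurable.mk θ s‖ ≤ ‖θ₀‖}
    · rw [Set.indicator_of_mem hs]
      exact hs
    · rw [Set.indicator_of_notMem hs, norm_zero]
      exact norm_nonneg _
  · filter_upwards [hθ.measurable.ae_eq_mk, ae_restrict_mem measurableSet_Ioi] with s h1 h2
    have hs : s ∈ {s | ‖hθ.measurable.mk θ s‖ ≤ ‖θ₀‖} := by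
      change ‖hθ.measurable.mk θ s‖ ≤ ‖θ₀‖
      rw [← h1]
      exact hθ.norm_le (le_of_lt h2)
    rw [Set.indicator_of_mem hs, h1]

lemma stronglyMeasurable_transportSymbol {Θ : ℝ → RealL2} (hΘ : StronglyMeasurable Θ) :
    StronglyMeasurable (Function.uncurry fun s ξ => transportSymbol (Θ s) ξ) := by
  have h : StronglyMeasurable fun p : ℝ × Plane => (Θ p.1, p.2) :=
    (hΘ.comp_measurable measurable_fst).prodMk measurable_snd.stronglyMeasurable
  exact Continuous.comp_stronglyMeasurable (f := fun p : ℝ × Plane => (Θ p.1, p.2))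
    (g := fun p : RealL2 × Plane => transportSymbol p.1 p.2) continuous_transportSymbol h

lemma norm_transportSymbol_le_of_norm_le {Θ : ℝ → RealL2} {A : ℝ} (hΘ : ∀ s, ‖Θ s‖ ≤ A) (s : ℝ)
    (ξ : Plane) : ‖transportSymbol (Θ s) ξ‖ ≤ 4 * Real.pi * A ^ 2 * ‖ξ‖ := by
  refine (norm_transportSymbol_le _ _).trans ?_
  have := Real.pi_pos
  gcongr
  exact hΘ s

lemma IsWeakSolution.isFourierSolution (hθ : IsWeakSolution α β θ₀ θ) (hα : 0 < α) (hβ : 0 < β)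
    {Θ : ℝ → RealL2} (hΘ : θ =ᵐ[volume.restrict (Set.Ioi (0 : ℝ))] Θ) :
    IsFourierSolution (dissipationSymbol α β) (fun s ξ => transportSymbol (Θ s) ξ) (spectrum θ₀)
      fun t => spectrum (θ t) where
  measurable := continuous_spectrum.comp_aestronglyMeasurable hθ.measurable
  locally_bounded T := ⟨‖θ₀‖, fun t ht => (norm_spectrum _).trans_le (hθ.norm_le ht.1)⟩
  equation χ t ht := by
    have h := hθ.equation (𝓕⁻ χ) t ht
    rw [integral_ofReal_mul_schwartz, integral_ofReal_mul_schwartz] at h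
    rw [h]
    refine intervalIntegral.integral_congr_ae ?_
    have h1 := (ae_restrict_iff' measurableSet_Ioi).mp hΘ
    filter_upwards [h1] with s hs hmem
    rw [Set.uIoc_of_le ht] at hmem
    rw [transportPairing_eq, dissipationPairing_eq hα hβ, hs hmem.1]

lemma IsLinearSolution.isFourierSolution (hθ : IsLinearSolution α β θ₀ θ) (hα : 0 < α)
    (hβ : 0 < β) : IsFourierSolution (dissipationSymbol α β) (fun _ _ => 0) (spectrum θ₀)
      fun t => spectrum (θ t) where
  measurable := continuous_spectrum.comp_aestronglyMeasurable hθ.measurable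
  locally_bounded T := by
    obtain ⟨M, hM⟩ := hθ.locally_bounded T
    exact ⟨M, fun t ht => (norm_spectrum _).trans_le (hM t ht)⟩
  equation χ t ht := by
    have h := hθ.equation (𝓕⁻ χ) t ht
    rw [integral_ofReal_mul_schwartz, integral_ofReal_mul_schwartz] at h
    rw [h, ← intervalIntegral.integral_neg]
    refine intervalIntegral.integral_congr fun s _ => ?_
    simp only [dissipationPairing_eq hα hβ, zero_mul, integral_zero, zero_sub]

lemma enorm_sq_eq_ofReal (f : RealL2) {V : Plane → ℂ} (hV : spectrum f =ᵐ[volume] V) :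
    ‖f‖ₑ ^ 2 = ENNReal.ofReal (∫ ξ, ‖V ξ‖ ^ 2) := by
  have h : ∫ ξ, ‖V ξ‖ ^ 2 = ‖f‖ ^ 2 := by
    rw [← norm_spectrum, norm_sq_eq_integral]
    refine integral_congr_ae ?_
    filter_upwards [hV] with ξ hξ
    rw [hξ]
  rw [h, ENNReal.ofReal_pow (norm_nonneg _), ofReal_norm]

lemma absDerivNormSq_eq_lintegral (j : Fin 2) (s : ℝ) (f : RealL2) {V : Plane → ℂ}
    (hV : spectrum f =ᵐ[volume] V) :
    absDerivNormSq j s f =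
      ∫⁻ ξ, ENNReal.ofReal (absDerivSymbol j (2 * s) ξ * ‖V ξ‖ ^ 2) := by
  refine lintegral_congr_ae ?_
  filter_upwards [hV, coeFn_spectrum f] with ξ h1 h2
  have h0 : 0 ≤ absDerivSymbol j s ξ := by
    unfold absDerivSymbol
    positivity
  have h3 : ‖V ξ‖ = ‖(𝓕 (toComplex f) : ComplexL2) ξ‖ := by rw [← h1, h2, norm_star]
  have h4 : absDerivSymbol j (2 * s) ξ = absDerivSymbol j s ξ ^ 2 := by
    unfold absDerivSymbol
    rw [mul_comm 2 s, Real.rpow_mul (by positivity), Real.rpow_two]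
  rw [h3, h4, ← mul_pow, ENNReal.ofReal_pow (by positivity), ← ofReal_norm, norm_mul,
    Complex.norm_real, Real.norm_of_nonneg h0]

lemma absDerivNormSq_add (f : RealL2) {V : Plane → ℂ} (hV : spectrum f =ᵐ[volume] V) :
    absDerivNormSq 0 α f + absDerivNormSq 1 β f =
      ∫⁻ ξ, ENNReal.ofReal (dissipationSymbol α β ξ * ‖V ξ‖ ^ 2) := by
  have hVm : AEStronglyMeasurable V volume := (Lp.aestronglyMeasurable (spectrum f)).congr hV
  rw [absDerivNormSq_eq_lintegral 0 α f hV, absDerivNormSq_eq_lintegral 1 β f hV,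
    ← lintegral_add_left']
  · refine lintegral_congr fun ξ => ?_
    have h : ∀ (j : Fin 2) (s : ℝ), 0 ≤ absDerivSymbol j s ξ := fun j s => by
      unfold absDerivSymbol
      positivity
    have := h 0 (2 * α)
    have := h 1 (2 * β)
    rw [← ENNReal.ofReal_add (by positivity) (by positivity), dissipationSymbol, add_mul]
  · exact ((measurable_absDerivSymbol 0 (2 * α)).aemeasurable.mul
      (hVm.norm.aemeasurable.pow_const 2)).ennreal_ofReal

end Transfer

end AnisoSQG

end

/-! ### The decay estimate -/

theorem theorem1p5 (α β : ℝ) (hα : 0 < α) (hβ : 0 < β)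
    (hαβ : 4 * α * β < min (α + 3 * β) (3 * α + β)) (θ₀ : AnisoSQG.RealL2) :
    ∃ C₀ : ℝ, 0 < C₀ ∧
      ∀ θ θlin : ℝ → AnisoSQG.RealL2,
        AnisoSQG.IsWeakSolution α β θ₀ θ → AnisoSQG.IsLinearSolution α β θ₀ θlin →
          ∀ t : ℝ, 0 ≤ t →
            ‖θ t - θlin t‖ ≤ C₀ * (1 + t) ^
              (-((min (α + 3 * β) (3 * α + β) - 4 * α * β) / (8 * α * β))) := by
  open AnisoSQG in
  set μ := min (α + 3 * β) (3 * α + β) with hμ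
  have hm := continuous_dissipationSymbol hα.le hβ.le
  have hm0 := dissipationSymbol_nonneg α β
  have hγ : 0 < (μ - 4 * α * β) / (4 * α * β) := div_pos (by linarith) (by positivity)
  obtain ⟨c, hc, hJ⟩ := exists_integral_normSq_mul_exp_le hα hβ
  have hC : 0 ≤ 4 * Real.pi * ‖θ₀‖ ^ 2 := by
    have := Real.pi_pos
    positivity
  -- With γ = (μ - 4αβ)/(4αβ), 2γ + 2 is exactly the decay exponent of the Gaussian-type integral.
  have hexp : 2 * ((μ - 4 * α * β) / (4 * α * β)) + 2 = μ / (2 * α * β) := by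
    field_simp
    ring
  obtain ⟨M, hM0, hM⟩ := exists_decay_duhamelIntegral (X₀ := spectrum θ₀) hm hm0 hC
    (Lp.memLp _) hγ hc (fun τ hτ => (hJ τ hτ).1) (fun τ hτ => by
      rw [hexp]
      exact (hJ τ (by linarith)).2 hτ)
  -- `M` is fixed before the forcing, from the bound |N| ≤ 4π‖θ₀‖²|ξ| alone, so the constant serves
  -- all weak solutions at once.
  refine ⟨√M, Real.sqrt_pos.mpr hM0, fun θ θlin hθ hlin t ht => ?_⟩
  obtain ⟨Θ, hΘm, hΘb, hΘ⟩ := hθ.exists_modification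
  set N : ℝ → Plane → ℂ := fun s ξ => transportSymbol (Θ s) ξ with hN
  have hNm := stronglyMeasurable_transportSymbol hΘm
  have hNb := norm_transportSymbol_le_of_norm_le hΘb
  have hV : ∀ t, 0 ≤ t →
      spectrum (θ t) =ᵐ[volume] duhamel (dissipationSymbol α β) N (spectrum θ₀) t :=
    fun t ht => (hθ.isFourierSolution hα hβ hΘ).ae_eq_duhamel hm hm0 hNm hC hNb ht
  have hL : spectrum (θlin t) =ᵐ[volume]
      duhamel (dissipationSymbol α β) (fun _ _ => 0) (spectrum θ₀) t :=
    (hlin.isFourierSolution hα hβ).ae_eq_duhamel hm hm0 stronglyMeasurable_const hC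
      (fun s ξ => by rw [norm_zero]; positivity) ht
  have hsq : ∀ t, 0 ≤ t →
      ∫ ξ, ‖duhamel (dissipationSymbol α β) N (spectrum θ₀) t ξ‖ ^ 2 = ‖θ t‖ ^ 2 := by
    intro t ht
    rw [← norm_spectrum, norm_sq_eq_integral]
    refine integral_congr_ae ?_
    filter_upwards [hV t ht] with ξ hξ
    rw [hξ]
  have hdecay := hM N hNm hNb (fun t ht => (Lp.memLp (spectrum (θ t))).ae_eq (hV t ht))
    (fun t ht => by
      rw [hsq t ht, ← norm_sq_eq_integral, norm_spectrum]
      gcongr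
      exact hθ.norm_le ht)
    (by
      filter_upwards [hθ.energy_ae, ae_restrict_mem measurableSet_Ioi] with s hs hs0 t hst
      have hs0 : 0 < s := hs0
      have h := hs t hst
      rw [enorm_sq_eq_ofReal _ (hV t (hs0.le.trans hst)), enorm_sq_eq_ofReal _ (hV s hs0.le)] at h
      rwa [setLIntegral_congr_fun measurableSet_Ioc fun τ hτ =>
        absDerivNormSq_add (θ τ) (hV τ (hs0.le.trans hτ.1.le))] at h) t ht
  -- The two Duhamel formulas share the term e^{-tm}X₀, so the difference is precisely the Duhamel
  -- integral of the forcing.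
  have hdiff : ‖θ t - θlin t‖ ^ 2 ≤
      M * (1 + t) ^ (-((μ - 4 * α * β) / (4 * α * β))) := by
    refine le_trans (le_of_eq ?_) hdecay
    rw [← norm_spectrum, norm_sq_eq_integral, spectrum_sub]
    refine integral_congr_ae ?_
    filter_upwards [Lp.coeFn_sub (spectrum (θ t)) (spectrum (θlin t)), hV t ht, hL]
      with ξ h1 h2 h3
    rw [h1, Pi.sub_apply, h2, h3]
    simp [duhamel, duhamelIntegral]
  refine le_of_sq_le_sq ?_ (by positivity)
  refine hdiff.trans (le_of_eq ?_)
  rw [mul_pow, Real.sq_sqrt hM0.le, ← Real.rpow_mul_natCast (by positivity)]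
  congr 2
  push_cast
  field_simp
  ring
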